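/- Let $\mathcal H$ be the Hilbert space with orthonormal basis $e^{(n)}_{ij}$, $n\in\frac12\mathbb N$, $i,j\in\{-n,-n+1,\dots,n\}$, and let $\alpha,\beta$ be the bounded operators on $\mathcal H$ (the generators of $SU_q(2)$ for $q=0$) given by $$\alpha e^{(n)}_{ij}=e^{(n-1/2)}_{i-1/2,\,j-1/2}\ \text{ if } i>-n \text{ and } j>-n,\qquad \alpha e^{(n)}_{ij}=0\ \text{ if } i=-n \text{ or } j=-n,$$ $$\beta e^{(n)}_{ij}=0\ \text{ if } i\ne -n \text{ and } j\neq -n,\qquad \beta e^{(n)}_{-n,j}=e^{(n-1/2)}_{-(n-1/2),\,j-1/2}\ \text{ if } j\neq -n,\qquad \beta e^{(n)}_{i,-n}=-e^{(n+1/2)}_{i+1/2,\,-(n+1/2)}.$$ Let $A$ be the C*-algebra of operators on $\mathcal H$ generated by $\alpha$ and $\beta$; it contains $1=\alpha\alpha^*$. For $f\in C^\infty(S^1)$ with Fourier coefficients $\hat f_n$ put $$f(\beta)=\sum_{n>0}\hat f_n\beta^n+\sum_{n<0}\hat f_n\beta^{*(-n)}+\hat f_0\,\beta^*\beta .$$ Let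 $\mathcal A$ be the set of all operators $$a=\sum_{k,\ell\ge 0}\alpha^{*k}f_{k\ell}(\beta)\,\alpha^{\ell}+\sum_{\ell\ge0}\lambda_\ell\,\alpha^\ell+\sum_{k>0}\lambda'_k\,\alpha^{*k},$$ where $\lambda,\lambda'$ are sequences of complex numbers of rapid decay and $(f_{k\ell})$ is a double sequence of rapid decay with values in the Fréchet space $C^\infty(S^1)$, i.e. $\sup_{k,\ell,\theta}(1+k+\ell)^p\,|\partial_\theta^m f_{k\ell}(\theta)|<\infty$ for all $m,p\in\mathbb N$. Then $\mathcal A\subset A$, and $\mathcal A$ is a unital subalgebra of $A$ which is stable under holomorphic functional calculus in $A$: for every $a\in\mathcal A$ and every function $g$ holomorphic on an open neighbourhood $U$ of the spectrum of $a$ in $A$, one has $$g(a)=\frac1{2\pi i}\oint_\Gamma g(z)(z-a)^{-1}\,dz\in\mathcal A$$ (for any $C^1$ cycle $\Gamma$ in $U\setminus\mathrm{Spec}_A(a)$ with winding number $1$ around each point of $\mathrm{Spec}_A(a)$ and $0$ around each point outside $U$). In particular, if $a\in\mathcal A$ is invertible in $A$, then $a^{-1}\in\mathcal A$. -/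

import Mathlib

open Set Topology
open scoped ContDiff InnerProductSpace

noncomputable section

/-! ### Holomorphic functional calculus in a unital complex Banach algebra -/

/-- A `C¹` cycle in `U \ K` surrounding `K`: finitely many closed `C¹` curves, parametrized by
`[0, 1]`, with total winding number `1` around each point of `K` and `0` around each point outside
`U`. (A `C¹` curve on `[0, 1]` is taken as the restriction of a `C¹` function on `ℝ`.) -/
structure SurroundingCycle (K U : Set ℂ) where
  /-- the number of curves -/
  card : ℕ
  /-- the curves -/
  path : Fin card → ℝ → ℂ
  contDiff : ∀ j, ContDiff ℝ 1 (path j)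
  closed : ∀ j, path j 0 = path j 1
  mem : ∀ j, ∀ t ∈ Icc (0 : ℝ) 1, path j t ∈ U \ K
  winding_eq_one : ∀ z ∈ K,
    (2 * Real.pi * Complex.I)⁻¹ *
      ∑ j, ∫ t in (0 : ℝ)..1, deriv (path j) t / (path j t - z) = 1
  winding_eq_zero : ∀ z ∉ U,
    (2 * Real.pi * Complex.I)⁻¹ *
      ∑ j, ∫ t in (0 : ℝ)..1, deriv (path j) t / (path j t - z) = 0

/-- The Riesz–Dunford integral `(2πi)⁻¹ ∮_Γ f(z) (z - x)⁻¹ dz`; it is `f(x)` if `f` is holomorphic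
on `U` and `Γ` is a cycle in `U` surrounding the spectrum of `x`. -/
def dunfordIntegral {B : Type*} [NormedRing B] [NormedAlgebra ℂ B] [CompleteSpace B]
    (f : ℂ → ℂ) {K U : Set ℂ} (Γ : SurroundingCycle K U) (x : B) : B :=
  (2 * Real.pi * Complex.I : ℂ)⁻¹ •
    ∑ j, ∫ t in (0 : ℝ)..1, (f (Γ.path j t) * deriv (Γ.path j) t) • resolvent x (Γ.path j t)

/-- A subalgebra `S` of a unital Banach algebra `B` is stable under holomorphic functional
calculus: `f(x) ∈ S` for all `x ∈ S` and all `f` holomorphic on a neighbourhood of the spectrum of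
`x` in `B`. -/
def StableUnderHolomorphicCalculus {B : Type*} [NormedRing B] [NormedAlgebra ℂ B]
    [CompleteSpace B] (S : Subalgebra ℂ B) : Prop :=
  ∀ x ∈ S, ∀ U : Set ℂ, IsOpen U → spectrum ℂ x ⊆ U → ∀ f : ℂ → ℂ, DifferentiableOn ℂ f U →
    ∀ Γ : SurroundingCycle (spectrum ℂ x) U, dunfordIntegral f Γ x ∈ S

namespace SUq0

/-! ### The Hilbert space and the operators `α`, `β` for `q = 0` -/

/-- The labels of the orthonormal basis `e_{ij}^{(n)}`, where `n ∈ ½ℕ` and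
`i, j ∈ {-n, -n+1, …, n}`, encoded by the natural numbers
`N = 2n`, `a = n + i`, `b = n + j`, so that `0 ≤ a, b ≤ N`. -/
@[ext]
structure Idx where
  N : ℕ
  a : ℕ
  b : ℕ
  ha : a ≤ N
  hb : b ≤ N

/-- The Hilbert space with orthonormal basis `e_{ij}^{(n)}`. -/
abbrev H : Type := lp (fun _ : Idx => ℂ) 2

/-- The basis vector `e_{ij}^{(n)}`. -/
def e (p : Idx) : H := by
  classical exact lp.single 2 p 1

theorem e_apply_self (p : Idx) : e p p = 1 := by
  simp [e]

theorem e_apply_ne {p r : Idx} (h : r ≠ p) : e p r = 0 := by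
  simp [e, h]

theorem sum_bound (c : Idx → ℂ) (φ : Idx → Idx) (hc : ∀ p, ‖c p‖ ≤ 1)
    (hφ : InjOn φ {p | c p ≠ 0}) (ξ : H) (s : Finset Idx) :
    ∑ p ∈ s, ‖c p * ξ (φ p)‖ ^ (2 : ENNReal).toReal ≤ ‖ξ‖ ^ (2 : ENNReal).toReal := by
  classical
  have h2 : (2 : ENNReal).toReal = 2 := by simp
  calc ∑ p ∈ s, ‖c p * ξ (φ p)‖ ^ (2 : ENNReal).toReal
      = ∑ p ∈ s with c p ≠ 0, ‖c p * ξ (φ p)‖ ^ (2 : ENNReal).toReal := by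
        rw [Finset.sum_filter]
        refine Finset.sum_congr rfl fun p _ => ?_
        split_ifs with h
        · rfl
        · simp only [ne_eq, not_not] at h
          simp [h]
    _ ≤ ∑ p ∈ s with c p ≠ 0, ‖ξ (φ p)‖ ^ (2 : ENNReal).toReal := by
        refine Finset.sum_le_sum fun p _ => ?_
        refine Real.rpow_le_rpow (norm_nonneg _) ?_ (by simp)
        rw [norm_mul]
        exact mul_le_of_le_one_left (norm_nonneg _) (hc p)
    _ = ∑ r ∈ (s.filter fun p => c p ≠ 0).image φ, ‖ξ r‖ ^ (2 : ENNReal).toReal := by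
        rw [Finset.sum_image]
        intro p hp r hr h
        exact hφ (by simpa using (Finset.mem_filter.1 hp).2)
          (by simpa using (Finset.mem_filter.1 hr).2) h
    _ ≤ ‖ξ‖ ^ (2 : ENNReal).toReal := lp.sum_rpow_le_norm_rpow (by simp) ξ _

/-- The bounded operator `(T ξ)(p) = c(p) ξ(φ(p))`, for `|c| ≤ 1` and `φ` injective on the support
of `c`. -/
def coordOp (c : Idx → ℂ) (φ : Idx → Idx) (hc : ∀ p, ‖c p‖ ≤ 1)
    (hφ : InjOn φ {p | c p ≠ 0}) : H →L[ℂ] H :=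
  LinearMap.mkContinuous
    { toFun := fun ξ => ⟨fun p => c p * ξ (φ p), memℓp_gen' (sum_bound c φ hc hφ ξ)⟩
      map_add' := fun ξ η => by
        ext p
        exact mul_add (c p) (ξ (φ p)) (η (φ p))
      map_smul' := fun z ξ => by
        ext p
        simp [mul_left_comm] }
    1 (fun ξ => by
      rw [one_mul]
      exact lp.norm_le_of_forall_sum_le (by simp) (norm_nonneg _) (sum_bound c φ hc hφ ξ))

theorem coordOp_apply (c : Idx → ℂ) (φ : Idx → Idx) (hc : ∀ p, ‖c p‖ ≤ 1)
    (hφ : InjOn φ {p | c p ≠ 0}) (ξ : H) (p : Idx) :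
    coordOp c φ hc hφ ξ p = c p * ξ (φ p) := rfl

/-- The map `(n, i, j) ↦ (n + ½, i + ½, j + ½)`. -/
def shiftUp (p : Idx) : Idx :=
  ⟨p.N + 1, p.a + 1, p.b + 1, Nat.succ_le_succ p.ha, Nat.succ_le_succ p.hb⟩

theorem shiftUp_injective : Function.Injective shiftUp := by
  rintro ⟨N, a, b, h1, h2⟩ ⟨N', a', b', h1', h2'⟩ h
  simpa [shiftUp] using h

/-- The operator `α`: `α e_{ij}^{(n)} = e_{i-½,j-½}^{(n-½)}` if `i, j > -n`, and
`α e_{ij}^{(n)} = 0` if `i = -n` or `j = -n`. -/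
def α : H →L[ℂ] H :=
  coordOp (fun _ => 1) shiftUp (by simp) shiftUp_injective.injOn

theorem α_e_shiftUp (p : Idx) : α (e (shiftUp p)) = e p := by
  ext r
  rw [α, coordOp_apply, one_mul]
  by_cases h : r = p
  · rw [h, e_apply_self, e_apply_self]
  · rw [e_apply_ne h, e_apply_ne fun h' => h (shiftUp_injective h')]

theorem α_e_boundary (p : Idx) (hp : p.a = 0 ∨ p.b = 0) : α (e p) = 0 := by
  ext r
  rw [α, coordOp_apply, one_mul, e_apply_ne, lp.coeFn_zero, Pi.zero_apply]
  rintro rfl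
  simp [shiftUp] at hp

/-- The coefficients of `β`: `(β ξ)(p) = βcoeff p * ξ (βindex p)`. -/
def βcoeff (p : Idx) : ℂ := if p.a = 0 then 1 else if p.b = 0 then -1 else 0

/-- The label of the basis vector that `β` maps to `± e_p`, for `p.a = 0` or `p.b = 0`. -/
def βindex (p : Idx) : Idx :=
  if p.a = 0 then ⟨p.N + 1, 0, p.b + 1, Nat.zero_le _, Nat.succ_le_succ p.hb⟩
  else ⟨p.N - 1, p.a - 1, 0, Nat.sub_le_sub_right p.ha 1, Nat.zero_le _⟩

theorem norm_βcoeff_le (p : Idx) : ‖βcoeff p‖ ≤ 1 := by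
  unfold βcoeff
  split_ifs <;> simp

theorem βindex_injOn : InjOn βindex {p | βcoeff p ≠ 0} := by
  rintro ⟨N, a, b, h1, h2⟩ hp ⟨N', a', b', h1', h2'⟩ hp' h
  simp only [βcoeff, mem_ofPred_eq] at hp hp'
  simp only [βindex] at h
  split_ifs at h hp hp' <;> simp_all
  omega

/-- The operator `β`: `β e_{ij}^{(n)} = 0` if `i ≠ -n` and `j ≠ -n`,
`β e_{-n,j}^{(n)} = e_{-(n-½),j-½}^{(n-½)}` if `j ≠ -n`, and
`β e_{i,-n}^{(n)} = -e_{i+½,-(n+½)}^{(n+½)}`. -/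
def β : H →L[ℂ] H := coordOp βcoeff βindex norm_βcoeff_le βindex_injOn

theorem β_e_interior (p : Idx) (ha : p.a ≠ 0) (hb : p.b ≠ 0) : β (e p) = 0 := by
  ext r
  rw [β, coordOp_apply, lp.coeFn_zero, Pi.zero_apply]
  by_cases h : βindex r = p
  · subst h
    simp only [βindex] at ha hb
    split_ifs at ha hb <;> simp_all
  · rw [e_apply_ne h, mul_zero]

theorem β_e_left (N b : ℕ) (hb : b ≤ N) :
    β (e ⟨N + 1, 0, b + 1, Nat.zero_le _, Nat.succ_le_succ hb⟩) =
      e ⟨N, 0, b, Nat.zero_le _, hb⟩ := by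
  ext ⟨N', a', b', h1, h2⟩
  rw [β, coordOp_apply]
  by_cases ha : a' = 0
  · subst ha
    by_cases h : N' = N ∧ b' = b
    · obtain ⟨rfl, rfl⟩ := h
      simp [βcoeff, βindex, e_apply_self]
    · rw [e_apply_ne (by simpa [βindex] using h), e_apply_ne (by simpa using h), mul_zero]
  · rw [e_apply_ne (by simp [βindex, ha]), e_apply_ne (by simp [ha]), mul_zero]

theorem β_e_right (N a : ℕ) (ha : a ≤ N) :
    β (e ⟨N, a, 0, ha, Nat.zero_le _⟩) =
      -e ⟨N + 1, a + 1, 0, Nat.succ_le_succ ha, Nat.zero_le _⟩ := by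
  ext ⟨N', a', b', h1, h2⟩
  rw [β, coordOp_apply, lp.coeFn_neg, Pi.neg_apply]
  by_cases h0 : a' = 0
  · subst h0
    rw [e_apply_ne (by simp [βindex]), e_apply_ne (by simp), mul_zero, neg_zero]
  · by_cases hb : b' = 0
    · subst hb
      obtain ⟨a', rfl⟩ := Nat.exists_eq_succ_of_ne_zero h0
      obtain ⟨N', rfl⟩ := Nat.exists_eq_succ_of_ne_zero (by omega : N' ≠ 0)
      by_cases h : N' = N ∧ a' = a
      · obtain ⟨rfl, rfl⟩ := h
        simp [βcoeff, βindex, e_apply_self]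
      · rw [e_apply_ne (by simpa [βindex] using h), e_apply_ne (by simpa using h), mul_zero,
          neg_zero]
    · rw [e_apply_ne (p := ⟨N + 1, a + 1, 0, _, _⟩) (by simp [hb])]
      simp [βcoeff, h0, hb]

/-- The C*-algebra `A` of operators on `H` generated by `α` and `β`. (It contains `1 = α α*`.) -/
def cstarA : StarSubalgebra ℂ (H →L[ℂ] H) :=
  (StarAlgebra.adjoin ℂ {α, β}).topologicalClosure

instance : CompleteSpace cstarA :=
  inferInstanceAs (CompleteSpace (StarAlgebra.adjoin ℂ {α, β}).topologicalClosure)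

/-! ### The smooth algebra -/

/-- `β ^ n` for `n > 0`, `(β*) ^ (-n)` for `n < 0`, and the projection `β* β` for `n = 0`. -/
def βpow (n : ℤ) : H →L[ℂ] H :=
  if 0 < n then β ^ n.toNat else if n < 0 then (star β) ^ (-n).toNat else star β * β

/-- `f(β) = ∑_{n > 0} f̂_n β ^ n + ∑_{n < 0} f̂_n (β*) ^ (-n) + f̂_0 e`, with `e = β* β` and
`f̂_n` the Fourier coefficients of the smooth `2π`-periodic function `f` of `θ`. (The series
converges absolutely, since `(f̂_n)` decays rapidly and `‖β‖ ≤ 1`.) -/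
def ofβ (f : ℝ → ℂ) : H →L[ℂ] H :=
  ∑' n : ℤ, fourierCoeffOn Real.two_pi_pos f n • βpow n

/-- Sequences of complex numbers of rapid decay. -/
def RapidDecay (c : ℕ → ℂ) : Prop :=
  ∀ p : ℕ, ∃ C : ℝ, ∀ k : ℕ, (1 + (k : ℝ)) ^ p * ‖c k‖ ≤ C

/-- Double sequences of rapid decay with values in the Fréchet space `C^∞(S¹)`, whose elements are
the smooth `2π`-periodic functions of `θ`, with the seminorms `sup |∂_θ^m f|`. -/
structure SmoothRapidDecay (f : ℕ → ℕ → ℝ → ℂ) : Prop where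
  contDiff : ∀ k l, ContDiff ℝ ∞ (f k l)
  periodic : ∀ k l, Function.Periodic (f k l) (2 * Real.pi)
  decay : ∀ m p : ℕ, ∃ C : ℝ, ∀ (k l : ℕ) (θ : ℝ),
    (1 + (k : ℝ) + (l : ℝ)) ^ p * ‖iteratedDeriv m (f k l) θ‖ ≤ C

/-- The operators
`∑_{k,l ≥ 0} α*^k f_{kl}(β) α^l + ∑_{l ≥ 0} lam_l α^l + ∑_{k > 0} lam'_k α*^k`
(norm-convergent series) with `(f_{kl})`, `lam`, `lam'` of rapid decay. -/
def smoothA : Set (H →L[ℂ] H) :=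
  {x | ∃ (f : ℕ → ℕ → ℝ → ℂ) (lam lam' : ℕ → ℂ),
    SmoothRapidDecay f ∧ RapidDecay lam ∧ RapidDecay lam' ∧
    ∃ x₁ x₂ x₃ : H →L[ℂ] H,
      HasSum (fun p : ℕ × ℕ => (star α) ^ p.1 * ofβ (f p.1 p.2) * α ^ p.2) x₁ ∧
      HasSum (fun l : ℕ => lam l • α ^ l) x₂ ∧
      HasSum (fun k : ℕ => lam' (k + 1) • (star α) ^ (k + 1)) x₃ ∧
      x = x₁ + x₂ + x₃}

end SUq0

end

/-! In the coordinates k = min(a, b), d = a - b, m = N - max(a, b), and after a change of signs, the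
Hilbert space becomes ℓ²(ℕ) ⊗ ℓ²(ℤ) ⊗ ℓ²(ℕ). There α is the backward shift in k, and β is the rank
one projection onto k = 0 tensored with the bilateral shift in d. So A lies in the commutant `commA`
of the shifts in d and m, and an element of this commutant is determined by the coefficients `coef
(k, l, n)`, which are dual to the matrix units `cell (k, l, n)` = α*^k β^n α^l.

The smooth algebra consists of the operators `toep φ + w`, where φ is a rapidly decreasing sequence
on ℤ, the symbol, and w is smoothing: it lies in `commA` and all its weighted ℓ¹ norms `JN p` are
finite (`mem_smoothA_iff`). The passage between functions on the circle and coefficients is Fourier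
analysis. Smoothing operators are closed under products and under multiplication by `toep φ` on
either side. Moreover `toep φ * toep ψ - toep (conv φ ψ)` is smoothing, because `tau i * tau j` and
`tau (i + j)` differ by finitely many cells (`tau_mul_tau`). Hence the smooth operators form an
algebra.

For inverses, let D = z - (toep φ + x) have inverse y. Unit vectors that are asymptotically
eigenvectors of α and α*, and are asymptotically annihilated by every cell, show that the symbol z -
σ(θ) of D is bounded below by 1/‖y‖ (`one_le_mul_symbol`). Its reciprocal is smooth, so its Fourier
coefficients ψ decrease rapidly, and b = toep ψ is a parametrix: r = D b - 1 and r' = b D - 1 are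
smoothing. Then y - b = r' y r - b r, and only r' y r needs work. The outer factors supply decay in
k and l, so it suffices that the coefficients of y decay in the d direction, uniformly in the rest
(`UJ.mul_mul`). This comes from the circle action `ad`: it fixes the Toeplitz part and rotates the
cells, so θ ↦ ad θ D is smooth, hence so is its inverse θ ↦ ad θ y, whose derivatives multiply
coefficients by powers of d - d' (`inverse_bound`).

All estimates are uniform over families with ‖z‖ and ‖y‖ bounded (`exists_symbol_inverse`). On a
compact curve in the resolvent set they therefore pass through the integral, symbol and remainder
separately (`isSmooth_integral`), which gives the functional calculus. A one-element family gives
closure under inversion. -/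

noncomputable section

namespace SUq0

/-! ### Adapted coordinates on the basis -/

/-- The label with coordinates `k = min(a, b)`, `d = a - b`, `m = N - max(a, b)`. -/
def idx (k : ℕ) (d : ℤ) (m : ℕ) : Idx :=
  ⟨k + d.natAbs + m, k + d.toNat, k + (-d).toNat, by omega, by omega⟩

theorem idx_inj {k k' m m' : ℕ} {d d' : ℤ} :
    idx k d m = idx k' d' m' ↔ k = k' ∧ d = d' ∧ m = m' := by
  simp only [idx, Idx.mk.injEq]
  omega

theorem exists_idx (p : Idx) : ∃ k d m, p = idx k d m := by
  obtain ⟨N, a, b, ha, hb⟩ := p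
  refine ⟨min a b, (a : ℤ) - b, N - max a b, ?_⟩
  simp only [idx, Idx.mk.injEq]
  omega

theorem shiftUp_idx (k : ℕ) (d : ℤ) (m : ℕ) : shiftUp (idx k d m) = idx (k + 1) d m := by
  simp only [idx, shiftUp, Idx.mk.injEq]
  omega

/-- The basis vectors in the adapted coordinates, with signs that turn `β` into a shift. -/
def vec (k : ℕ) (d : ℤ) (m : ℕ) : H := (-1 : ℂ) ^ d.toNat • e (idx k d m)

theorem e_idx (k : ℕ) (d : ℤ) (m : ℕ) : e (idx k d m) = (-1 : ℂ) ^ d.toNat • vec k d m := by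
  rw [vec, smul_smul, ← mul_pow]
  simp

theorem inner_e_left (p : Idx) (ξ : H) : ⟪e p, ξ⟫_ℂ = ξ p := by
  classical
  have := lp.inner_single_left (𝕜 := ℂ) p (1 : ℂ) ξ
  simpa [e] using this

theorem norm_e (p : Idx) : ‖e p‖ = 1 := by
  classical
  rw [e, lp.norm_single (by simp), norm_one]

theorem norm_vec (k : ℕ) (d : ℤ) (m : ℕ) : ‖vec k d m‖ = 1 := by
  simp [vec, norm_smul, norm_e]

theorem inner_vec_vec (k k' m m' : ℕ) (d d' : ℤ) :
    ⟪vec k d m, vec k' d' m'⟫_ℂ = if k = k' ∧ d = d' ∧ m = m' then 1 else 0 := by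
  rw [vec, vec, inner_smul_left, inner_smul_right, inner_e_left]
  split_ifs with h
  · obtain ⟨rfl, rfl, rfl⟩ := h
    rw [e_apply_self]
    simp [← mul_pow]
  · rw [e_apply_ne (by rwa [Ne, idx_inj]), mul_zero, mul_zero]

theorem hasSum_e (ξ : H) : HasSum (fun p => ξ p • e p) ξ := by
  classical
  convert lp.hasSum_single (p := 2) (by simp) ξ using 2 with p
  rw [e, ← lp.single_smul]
  simp

theorem ext_e {x y : H →L[ℂ] H} (h : ∀ p, x (e p) = y (e p)) : x = y := by
  ext1 ξ
  have hx := (hasSum_e ξ).mapL x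
  have hy := (hasSum_e ξ).mapL y
  simp only [map_smul, h] at hx hy
  exact hx.unique hy

theorem ext_vec {x y : H →L[ℂ] H} (h : ∀ k d m, x (vec k d m) = y (vec k d m)) : x = y := by
  refine ext_e fun p => ?_
  obtain ⟨k, d, m, rfl⟩ := exists_idx p
  simp only [e_idx, map_smul, h]

theorem vec_eq_zero_of_inner {ξ : H} (h : ∀ k d m, ⟪vec k d m, ξ⟫_ℂ = 0) : ξ = 0 := by
  ext p
  obtain ⟨k, d, m, rfl⟩ := exists_idx p
  rw [← inner_e_left, e_idx, inner_smul_left, h]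
  simp

/-! ### The generators in the adapted coordinates -/

theorem star_coordOp_e (c : Idx → ℂ) (φ : Idx → Idx) (hc : ∀ p, ‖c p‖ ≤ 1)
    (hφ : InjOn φ {p | c p ≠ 0}) (p : Idx) :
    star (coordOp c φ hc hφ) (e p) = (starRingEnd ℂ) (c p) • e (φ p) := by
  ext q
  rw [← inner_e_left, ContinuousLinearMap.star_eq_adjoint,
    ContinuousLinearMap.adjoint_inner_right, ← inner_conj_symm, inner_e_left, coordOp_apply,
    lp.coeFn_smul, Pi.smul_apply, smul_eq_mul, map_mul]
  congr 1
  by_cases h : φ p = q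
  · subst h
    simp [e_apply_self]
  · rw [e_apply_ne h, e_apply_ne (Ne.symm h), map_zero]

theorem coordOp_e (c : Idx → ℂ) (φ : Idx → Idx) (hc : ∀ p, ‖c p‖ ≤ 1)
    (hφ : InjOn φ {p | c p ≠ 0}) (p : Idx) (hp : c p ≠ 0) :
    coordOp c φ hc hφ (e (φ p)) = c p • e p := by
  ext q
  rw [coordOp_apply, lp.coeFn_smul, Pi.smul_apply, smul_eq_mul]
  by_cases h : q = p
  · subst h
    rw [e_apply_self, e_apply_self]
  · rw [e_apply_ne h, mul_zero]
    by_cases hq : c q = 0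
    · rw [hq, zero_mul]
    · rw [e_apply_ne fun h' => h (hφ hq hp h'), mul_zero]

theorem α_vec_succ (k : ℕ) (d : ℤ) (m : ℕ) : α (vec (k + 1) d m) = vec k d m := by
  rw [vec, map_smul, ← shiftUp_idx, α_e_shiftUp, vec]

theorem α_vec_zero (d : ℤ) (m : ℕ) : α (vec 0 d m) = 0 := by
  rw [vec, map_smul, α_e_boundary, smul_zero]
  simp only [idx]
  omega

theorem star_α_vec (k : ℕ) (d : ℤ) (m : ℕ) : star α (vec k d m) = vec (k + 1) d m := by
  rw [vec, map_smul, α, star_coordOp_e, shiftUp_idx, vec]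
  simp

theorem star_β_vec_succ (k : ℕ) (d : ℤ) (m : ℕ) : star β (vec (k + 1) d m) = 0 := by
  rw [vec, map_smul, β, star_coordOp_e]
  simp [βcoeff, idx]

theorem star_β_vec_zero (d : ℤ) (m : ℕ) : star β (vec 0 d m) = vec 0 (d - 1) m := by
  have hi : βindex (idx 0 d m) = idx 0 (d - 1) m := by
    simp only [βindex, idx, zero_add]
    split_ifs with h <;> simp only [Idx.mk.injEq] <;> omega
  rw [vec, map_smul, β, star_coordOp_e, hi, vec, smul_smul]
  congr 1
  simp only [βcoeff, idx, zero_add]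
  -- The coordinate a vanishes exactly when d ≤ 0. There β has coefficient 1 and both signs are
  -- trivial; for d > 0 the coefficient -1 absorbs the change of sign between d and d - 1.
  split_ifs with h h'
  · have : (d - 1).toNat = d.toNat := by omega
    simp [this]
  · obtain ⟨j, hj⟩ : ∃ j, j = (d - 1).toNat := ⟨_, rfl⟩
    have : d.toNat = j + 1 := by omega
    rw [this, ← hj, pow_succ]
    simp
  · omega

theorem β_vec_succ (k : ℕ) (d : ℤ) (m : ℕ) : β (vec (k + 1) d m) = 0 := by
  rw [vec, map_smul, β_e_interior, smul_zero] <;> simp [idx]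

theorem β_vec_zero (d : ℤ) (m : ℕ) : β (vec 0 d m) = vec 0 (d + 1) m := by
  -- The action of β is read off from that of its adjoint by pairing with all basis vectors.
  refine sub_eq_zero.1 (vec_eq_zero_of_inner fun k' d' m' => ?_)
  rw [inner_sub_right, ← ContinuousLinearMap.adjoint_inner_left,
    ← ContinuousLinearMap.star_eq_adjoint]
  rcases k' with _ | k'
  · rw [star_β_vec_zero, inner_vec_vec, inner_vec_vec, sub_eq_zero]
    congr 1
    simp only [true_and, eq_iff_iff]
    omega
  · rw [star_β_vec_succ, inner_vec_vec]
    simp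

/-! ### Operators commuting with the algebra -/

theorem exists_shift_d : ∃ W : H →L[ℂ] H, (∀ k d m, W (vec k d m) = vec k (d + 1) m) ∧
    ∀ k d m, star W (vec k d m) = vec k (d - 1) m := by
  classical
  choose k d m hp using exists_idx
  have hk : ∀ k' d' m', k (idx k' d' m') = k' ∧ d (idx k' d' m') = d' ∧ m (idx k' d' m') = m' :=
    fun k' d' m' => by
      have := hp (idx k' d' m')
      rw [idx_inj] at this
      simp [← this]
  -- The product of the signs built into `vec` at d and at d - 1, so that the signed vectors are
  -- shifted without sign.
  let c : Idx → ℂ := fun p => (-1) ^ (d p).toNat * (-1) ^ (d p - 1).toNat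
  have hφ : InjOn (fun p => idx (k p) (d p - 1) (m p)) {p | c p ≠ 0} := fun p _ q _ h => by
    simp only [idx_inj] at h
    rw [hp p, hp q, idx_inj]
    exact ⟨h.1, by omega, h.2.2⟩
  have hc : ∀ p, ‖c p‖ ≤ 1 := fun p => by simp [c]
  have hs : ∀ k d m, star (coordOp c _ hc hφ) (vec k d m) = vec k (d - 1) m := fun k d m => by
    rw [vec, map_smul, star_coordOp_e, (hk k d m).1, (hk k d m).2.1, (hk k d m).2.2, vec,
      smul_smul]
    simp only [c, (hk k d m).2.1, map_mul, map_pow, map_neg, map_one]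
    rw [← mul_assoc, ← mul_pow]
    simp
  refine ⟨coordOp c _ hc hφ, fun k d m => ?_, hs⟩
  refine sub_eq_zero.1 (vec_eq_zero_of_inner fun k' d' m' => ?_)
  rw [inner_sub_right, ← ContinuousLinearMap.adjoint_inner_left,
    ← ContinuousLinearMap.star_eq_adjoint, hs, inner_vec_vec, inner_vec_vec, sub_eq_zero]
  congr 1
  simp only [eq_iff_iff]
  omega

theorem exists_shift_m : ∃ W : H →L[ℂ] H, (∀ k d m, W (vec k d m) = vec k d (m + 1)) ∧
    (∀ k d m, star W (vec k d (m + 1)) = vec k d m) ∧ ∀ k d, star W (vec k d 0) = 0 := by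
  classical
  choose k d m hp using exists_idx
  have hk : ∀ k' d' m', k (idx k' d' m') = k' ∧ d (idx k' d' m') = d' ∧ m (idx k' d' m') = m' :=
    fun k' d' m' => by
      have := hp (idx k' d' m')
      rw [idx_inj] at this
      simp [← this]
  -- The coefficient must vanish at m = 0: the truncated m - 1 would identify m = 0 with m = 1 and
  -- destroy injectivity.
  let c : Idx → ℂ := fun p => if m p = 0 then 0 else 1
  have hφ : InjOn (fun p => idx (k p) (d p) (m p - 1)) {p | c p ≠ 0} := fun p hm q hm' h => by
    have h1 : m p ≠ 0 := fun h => hm (by simp [c, h])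
    have h2 : m q ≠ 0 := fun h => hm' (by simp [c, h])
    simp only [idx_inj] at h
    rw [hp p, hp q, idx_inj]
    exact ⟨h.1, h.2.1, by omega⟩
  have hc : ∀ p, ‖c p‖ ≤ 1 := fun p => by
    simp only [c]
    split_ifs <;> simp
  have hs : ∀ k d m, star (coordOp c _ hc hφ) (vec k d (m + 1)) = vec k d m := fun k d m => by
    rw [vec, map_smul, star_coordOp_e, (hk k d _).1, (hk k d _).2.1, (hk k d _).2.2, vec,
      smul_smul]
    simp [c, (hk k d (m + 1)).2.2]
  have hs0 : ∀ k d, star (coordOp c _ hc hφ) (vec k d 0) = 0 := fun k d => by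
    rw [vec, map_smul, star_coordOp_e]
    simp [c, (hk k d 0).2.2]
  refine ⟨coordOp c _ hc hφ, fun k d m => ?_, hs, hs0⟩
  refine sub_eq_zero.1 (vec_eq_zero_of_inner fun k' d' m' => ?_)
  rw [inner_sub_right, ← ContinuousLinearMap.adjoint_inner_left,
    ← ContinuousLinearMap.star_eq_adjoint]
  rcases m' with _ | m'
  · rw [hs0, inner_vec_vec]
    simp
  · rw [hs, inner_vec_vec, inner_vec_vec, sub_eq_zero]
    simp

/-- The bilateral shift in the coordinate `d`. -/
def shiftD : H →L[ℂ] H := exists_shift_d.choose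

/-- The unilateral shift in the coordinate `m`. -/
def shiftM : H →L[ℂ] H := exists_shift_m.choose

theorem shiftD_vec (k : ℕ) (d : ℤ) (m : ℕ) : shiftD (vec k d m) = vec k (d + 1) m :=
  exists_shift_d.choose_spec.1 k d m

theorem star_shiftD_vec (k : ℕ) (d : ℤ) (m : ℕ) : star shiftD (vec k d m) = vec k (d - 1) m :=
  exists_shift_d.choose_spec.2 k d m

theorem shiftM_vec (k : ℕ) (d : ℤ) (m : ℕ) : shiftM (vec k d m) = vec k d (m + 1) :=
  exists_shift_m.choose_spec.1 k d m

theorem star_shiftM_vec_succ (k : ℕ) (d : ℤ) (m : ℕ) :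
    star shiftM (vec k d (m + 1)) = vec k d m :=
  exists_shift_m.choose_spec.2.1 k d m

theorem star_shiftM_vec_zero (k : ℕ) (d : ℤ) : star shiftM (vec k d 0) = 0 :=
  exists_shift_m.choose_spec.2.2 k d

/-- The commutant of the two shifts; it contains the algebra generated by `α` and `β`. -/
def commA : StarSubalgebra ℂ (H →L[ℂ] H) := StarSubalgebra.centralizer ℂ {shiftD, shiftM}

theorem isClosed_commA : IsClosed (commA : Set (H →L[ℂ] H)) := by
  rw [commA, StarSubalgebra.coe_centralizer]
  exact Set.isClosed_centralizer _

theorem mem_commA {x : H →L[ℂ] H} : x ∈ commA ↔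
    (shiftD * x = x * shiftD ∧ star shiftD * x = x * star shiftD) ∧
      (shiftM * x = x * shiftM ∧ star shiftM * x = x * star shiftM) := by
  rw [commA, StarSubalgebra.mem_centralizer_iff]
  simp

theorem α_mem_commA : α ∈ commA := by
  rw [mem_commA]
  refine ⟨⟨?_, ?_⟩, ?_, ?_⟩ <;> refine ext_vec fun k d m => ?_ <;>
    rcases k with _ | k <;> rcases m with _ | m <;>
    simp [α_vec_succ, α_vec_zero, shiftD_vec, star_shiftD_vec, shiftM_vec, star_shiftM_vec_succ,
      star_shiftM_vec_zero]

theorem β_mem_commA : β ∈ commA := by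
  rw [mem_commA]
  refine ⟨⟨?_, ?_⟩, ?_, ?_⟩ <;> refine ext_vec fun k d m => ?_ <;>
    rcases k with _ | k <;> rcases m with _ | m <;>
    simp [β_vec_succ, β_vec_zero, shiftD_vec, star_shiftD_vec, shiftM_vec, star_shiftM_vec_succ,
      star_shiftM_vec_zero]

theorem cstarA_le_commA : cstarA ≤ commA := by
  refine StarSubalgebra.topologicalClosure_minimal (StarAlgebra.adjoin_le ?_) isClosed_commA
  rintro x (rfl | rfl)
  exacts [α_mem_commA, β_mem_commA]

/-- An element of the commutant vanishes as soon as its matrix coefficients between the vectors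
with `m = 0` and, on the right, `d = 0` vanish. -/
theorem eq_zero_of_mem_commA {x : H →L[ℂ] H} (hx : x ∈ commA)
    (h : ∀ k l n, ⟪vec k n 0, x (vec l 0 0)⟫_ℂ = 0) : x = 0 := by
  obtain ⟨⟨hD, hD'⟩, hM, hM'⟩ := mem_commA.1 hx
  have e1 : ∀ ξ, shiftD (x ξ) = x (shiftD ξ) := fun ξ => congr($hD ξ)
  have e2 : ∀ ξ, star shiftD (x ξ) = x (star shiftD ξ) := fun ξ => congr($hD' ξ)
  have e3 : ∀ ξ, shiftM (x ξ) = x (shiftM ξ) := fun ξ => congr($hM ξ)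
  have e4 : ∀ ξ, star shiftM (x ξ) = x (star shiftM ξ) := fun ξ => congr($hM' ξ)
  have h0 : ∀ l, x (vec l 0 0) = 0 := fun l => by
    refine vec_eq_zero_of_inner fun k d m => ?_
    rcases m with _ | m
    · exact h k l d
    · rw [← shiftM_vec, ← ContinuousLinearMap.adjoint_inner_right,
        ← ContinuousLinearMap.star_eq_adjoint, e4, star_shiftM_vec_zero]
      simp
  have h1 : ∀ l d, x (vec l d 0) = 0 := fun l d => by
    induction d using Int.induction_on with
    | zero => exact h0 l
    | succ d ih => rw [← shiftD_vec, ← e1, ih, map_zero]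
    | pred d ih => rw [← star_shiftD_vec, ← e2, ih, map_zero]
  refine ext_vec fun k d m => ?_
  rw [zero_apply]
  induction m with
  | zero => exact h1 k d
  | succ m ih => rw [← shiftM_vec, ← e3, ih, map_zero]

/-! ### The elementary operators -/

/-- `α*^k β^n α^l`, with the convention of `βpow` for `n ≤ 0`. -/
def cell (κ : ℕ × ℕ × ℤ) : H →L[ℂ] H := (star α) ^ κ.1 * βpow κ.2.2 * α ^ κ.2.1

/-- `α^n` for `n ≥ 0` and `α*^(-n)` for `n < 0`. -/
def tau (n : ℤ) : H →L[ℂ] H := if 0 ≤ n then α ^ n.toNat else (star α) ^ (-n).toNat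

theorem α_pow_vec (j k : ℕ) (d : ℤ) (m : ℕ) :
    (α ^ j) (vec k d m) = if j ≤ k then vec (k - j) d m else 0 := by
  induction j generalizing k with
  | zero => simp
  | succ j ih =>
    rw [pow_succ, mul_apply_eq_comp]
    rcases k with _ | k
    · rw [α_vec_zero, map_zero, if_neg (by omega)]
    · rw [α_vec_succ, ih]
      simp

theorem star_α_pow_vec (j k : ℕ) (d : ℤ) (m : ℕ) :
    ((star α) ^ j) (vec k d m) = vec (k + j) d m := by
  induction j generalizing k with
  | zero => simp
  | succ j ih =>
    rw [pow_succ, mul_apply_eq_comp, star_α_vec, ih]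
    congr 1
    omega

theorem β_pow_vec_zero (j : ℕ) (d : ℤ) (m : ℕ) : (β ^ j) (vec 0 d m) = vec 0 (d + j) m := by
  induction j generalizing d with
  | zero => simp
  | succ j ih =>
    rw [pow_succ, mul_apply_eq_comp, β_vec_zero, ih]
    congr 1
    push_cast
    ring

theorem star_β_pow_vec_zero (j : ℕ) (d : ℤ) (m : ℕ) :
    ((star β) ^ j) (vec 0 d m) = vec 0 (d - j) m := by
  induction j generalizing d with
  | zero => simp
  | succ j ih =>
    rw [pow_succ, mul_apply_eq_comp, star_β_vec_zero, ih]
    congr 1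
    push_cast
    ring

/-- The convention `βpow 0 = β* β` is what makes this uniform in n: each `βpow n` is the projection
onto k = 0 followed by the n-th power of the bilateral shift. -/
theorem βpow_vec (n : ℤ) (k : ℕ) (d : ℤ) (m : ℕ) :
    βpow n (vec k d m) = if k = 0 then vec 0 (d + n) m else 0 := by
  unfold βpow
  rcases k with _ | k
  · rw [if_pos rfl]
    split_ifs with h1 h2
    · rw [β_pow_vec_zero, Int.toNat_of_nonneg h1.le]
    · rw [star_β_pow_vec_zero, Int.toNat_of_nonneg (by omega), sub_neg_eq_add]
    · rw [mul_apply_eq_comp, β_vec_zero, star_β_vec_zero]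
      congr 1
      omega
  · rw [if_neg (Nat.succ_ne_zero k)]
    split_ifs with h1 h2
    · obtain ⟨j, hj⟩ : ∃ j, n.toNat = j + 1 := ⟨n.toNat - 1, by omega⟩
      rw [hj, pow_succ, mul_apply_eq_comp, β_vec_succ, map_zero]
    · obtain ⟨j, hj⟩ : ∃ j, (-n).toNat = j + 1 := ⟨(-n).toNat - 1, by omega⟩
      rw [hj, pow_succ, mul_apply_eq_comp, star_β_vec_succ, map_zero]
    · rw [mul_apply_eq_comp, β_vec_succ, map_zero]

/-- A cell is the matrix unit E_{kl} in the coordinate k, tensored with the n-th power of the shift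
in d. -/
theorem cell_vec (k l : ℕ) (n : ℤ) (j : ℕ) (d : ℤ) (m : ℕ) :
    cell (k, l, n) (vec j d m) = if j = l then vec k (d + n) m else 0 := by
  rw [cell, mul_apply_eq_comp, mul_apply_eq_comp, α_pow_vec]
  dsimp only
  split_ifs with h1 h2 h2
  · subst h2
    rw [βpow_vec, if_pos (by omega), star_α_pow_vec, zero_add]
  · rw [βpow_vec, if_neg (by omega), map_zero]
  · omega
  · simp

theorem tau_vec (n : ℤ) (k : ℕ) (d : ℤ) (m : ℕ) :
    tau n (vec k d m) = if n ≤ k then vec (k - n).toNat d m else 0 := by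
  unfold tau
  split_ifs with h1 h2 h2
  · rw [α_pow_vec, if_pos (by omega)]
    congr 1
    omega
  · rw [α_pow_vec, if_neg (by omega)]
  · rw [star_α_pow_vec]
    congr 1
    omega
  · omega

/-! ### Contractivity of the elementary operators and membership in the C*-algebra -/

theorem norm_coordOp_le (c : Idx → ℂ) (φ : Idx → Idx) (hc : ∀ p, ‖c p‖ ≤ 1)
    (hφ : InjOn φ {p | c p ≠ 0}) : ‖coordOp c φ hc hφ‖ ≤ 1 :=
  ContinuousLinearMap.opNorm_le_bound _ zero_le_one fun ξ => by
    rw [one_mul]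
    exact lp.norm_le_of_forall_sum_le (by simp) (norm_nonneg _) (sum_bound c φ hc hφ ξ)

theorem norm_α_le : ‖α‖ ≤ 1 := norm_coordOp_le _ _ _ _

theorem norm_β_le : ‖β‖ ≤ 1 := norm_coordOp_le _ _ _ _

theorem norm_pow_le_one {x : H →L[ℂ] H} (hx : ‖x‖ ≤ 1) (n : ℕ) : ‖x ^ n‖ ≤ 1 := by
  induction n with
  | zero =>
    rw [pow_zero]
    exact ContinuousLinearMap.norm_id_le
  | succ n ih =>
    rw [pow_succ]
    exact (norm_mul_le _ _).trans (mul_le_one₀ ih (norm_nonneg _) hx)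

theorem norm_mul_le_one {x y : H →L[ℂ] H} (hx : ‖x‖ ≤ 1) (hy : ‖y‖ ≤ 1) : ‖x * y‖ ≤ 1 :=
  (norm_mul_le _ _).trans (mul_le_one₀ hx (norm_nonneg _) hy)

theorem norm_βpow_le (n : ℤ) : ‖βpow n‖ ≤ 1 := by
  have hs : ‖star β‖ ≤ 1 := (norm_star β).trans_le norm_β_le
  unfold βpow
  split_ifs
  exacts [norm_pow_le_one norm_β_le _, norm_pow_le_one hs _, norm_mul_le_one hs norm_β_le]

theorem norm_cell_le (κ : ℕ × ℕ × ℤ) : ‖cell κ‖ ≤ 1 :=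
  norm_mul_le_one (norm_mul_le_one
    (norm_pow_le_one ((norm_star α).trans_le norm_α_le) _) (norm_βpow_le _))
    (norm_pow_le_one norm_α_le _)

theorem norm_tau_le (n : ℤ) : ‖tau n‖ ≤ 1 := by
  unfold tau
  split_ifs
  exacts [norm_pow_le_one norm_α_le _, norm_pow_le_one ((norm_star α).trans_le norm_α_le) _]

theorem α_mem_cstarA : α ∈ cstarA :=
  StarSubalgebra.le_topologicalClosure _ (StarAlgebra.subset_adjoin ℂ _ (by simp))

theorem β_mem_cstarA : β ∈ cstarA :=
  StarSubalgebra.le_topologicalClosure _ (StarAlgebra.subset_adjoin ℂ _ (by simp))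

theorem isClosed_cstarA : IsClosed (cstarA : Set (H →L[ℂ] H)) :=
  StarSubalgebra.isClosed_topologicalClosure _

theorem βpow_mem_cstarA (n : ℤ) : βpow n ∈ cstarA := by
  unfold βpow
  split_ifs
  exacts [pow_mem β_mem_cstarA _, pow_mem (star_mem β_mem_cstarA) _,
    mul_mem (star_mem β_mem_cstarA) β_mem_cstarA]

theorem cell_mem_cstarA (κ : ℕ × ℕ × ℤ) : cell κ ∈ cstarA :=
  mul_mem (mul_mem (pow_mem (star_mem α_mem_cstarA) _) (βpow_mem_cstarA _))
    (pow_mem α_mem_cstarA _)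

theorem tau_mem_cstarA (n : ℤ) : tau n ∈ cstarA := by
  unfold tau
  split_ifs
  exacts [pow_mem α_mem_cstarA _, pow_mem (star_mem α_mem_cstarA) _]

/-! ### The multiplication table -/

theorem cell_mul_cell (κ κ' : ℕ × ℕ × ℤ) : cell κ * cell κ' =
    if κ.2.1 = κ'.1 then cell (κ.1, κ'.2.1, κ.2.2 + κ'.2.2) else 0 := by
  obtain ⟨k, l, n⟩ := κ
  obtain ⟨k', l', n'⟩ := κ'
  refine ext_vec fun j d m => ?_
  rw [mul_apply_eq_comp, cell_vec]
  by_cases h : l = k'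
  · subst h
    by_cases hj : j = l'
    · simp [hj, cell_vec, add_assoc, add_comm n]
    · simp [hj, cell_vec]
  · by_cases hj : j = l'
    · simp [hj, cell_vec, h, Ne.symm h]
    · simp [hj, h]

theorem tau_mul_cell (j : ℤ) (κ : ℕ × ℕ × ℤ) : tau j * cell κ =
    if j ≤ κ.1 then cell ((κ.1 - j).toNat, κ.2.1, κ.2.2) else 0 := by
  obtain ⟨k, l, n⟩ := κ
  refine ext_vec fun i d m => ?_
  rw [mul_apply_eq_comp, cell_vec]
  by_cases hj : i = l <;> by_cases h : j ≤ k <;> simp [hj, h, tau_vec, cell_vec]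

theorem cell_mul_tau (j : ℤ) (κ : ℕ × ℕ × ℤ) : cell κ * tau j =
    if 0 ≤ κ.2.1 + j then cell (κ.1, (κ.2.1 + j).toNat, κ.2.2) else 0 := by
  obtain ⟨k, l, n⟩ := κ
  refine ext_vec fun i d m => ?_
  rw [mul_apply_eq_comp, tau_vec]
  by_cases h : j ≤ i
  · rw [if_pos h, cell_vec]
    by_cases h1 : (0 : ℤ) ≤ l + j
    · simp only [h1, if_true, cell_vec]
      refine if_congr (by omega) rfl rfl
    · rw [if_neg (by omega)]
      simp [h1]
  · rw [if_neg h, map_zero]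
    split_ifs with h1
    · rw [cell_vec, if_neg (by omega)]
    · simp

/-- `tau j` kills the layers k < j, whereas `tau (i + j)` kills only those with k < i + j. The two
sides differ exactly on the layers i + j ≤ k < j, and each contributes one cell. -/
theorem tau_mul_tau (i j : ℤ) : tau i * tau j = tau (i + j) -
    ∑ k ∈ Finset.range j.toNat with i + j ≤ (k : ℕ), cell ((k - i - j).toNat, k, 0) := by
  refine ext_vec fun k d m => ?_
  rw [mul_apply_eq_comp, sub_apply, tau_vec, tau_vec, sum_apply]
  simp only [cell_vec, Finset.sum_ite_eq, Finset.mem_filter, Finset.mem_range, add_zero]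
  by_cases h : j ≤ k
  · rw [if_pos h, tau_vec, if_neg (by omega : ¬ (k < j.toNat ∧ i + j ≤ k)), sub_zero]
    refine if_ctx_congr (by omega) (fun _ => ?_) fun _ => rfl
    congr 1
    omega
  · rw [if_neg h, map_zero]
    by_cases h1 : i + j ≤ k
    · rw [if_pos h1, if_pos ⟨by omega, h1⟩, sub_sub, sub_self]
    · simp [h1]

/-! ### Matrix coefficients -/

/-- The coefficient of `cell κ`. -/
def coef (κ : ℕ × ℕ × ℤ) : (H →L[ℂ] H) →L[ℂ] ℂ :=
  (innerSL ℂ (vec κ.1 κ.2.2 0)).comp (ContinuousLinearMap.apply ℂ H (vec κ.2.1 0 0))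

theorem coef_apply (κ : ℕ × ℕ × ℤ) (x : H →L[ℂ] H) :
    coef κ x = ⟪vec κ.1 κ.2.2 0, x (vec κ.2.1 0 0)⟫_ℂ := by
  simp [coef]

theorem norm_inner_vec_le (x : H →L[ℂ] H) (k d m k' d' m') :
    ‖⟪vec k d m, x (vec k' d' m')⟫_ℂ‖ ≤ ‖x‖ := by
  refine (norm_inner_le_norm _ _).trans ?_
  rw [norm_vec, one_mul]
  exact (x.le_opNorm _).trans_eq (by rw [norm_vec, mul_one])

theorem coef_cell (κ κ' : ℕ × ℕ × ℤ) : coef κ (cell κ') = if κ = κ' then 1 else 0 := by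
  obtain ⟨k, l, n⟩ := κ
  obtain ⟨k', l', n'⟩ := κ'
  rw [coef_apply, cell_vec]
  by_cases h : l = l'
  · simp [h, inner_vec_vec]
  · simp [h]

theorem coef_tau (κ : ℕ × ℕ × ℤ) (j : ℤ) :
    coef κ (tau j) = if κ.2.2 = 0 ∧ j = κ.2.1 - κ.1 then 1 else 0 := by
  obtain ⟨k, l, n⟩ := κ
  rw [coef_apply, tau_vec]
  dsimp only
  split_ifs with h1 h2 h2
  · rw [inner_vec_vec, if_pos]
    omega
  · rw [inner_vec_vec, if_neg]
    omega
  · omega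
  · simp

theorem eq_of_coef {x y : H →L[ℂ] H} (hx : x ∈ commA) (hy : y ∈ commA)
    (h : ∀ κ, coef κ x = coef κ y) : x = y := by
  refine sub_eq_zero.1 (eq_zero_of_mem_commA (sub_mem hx hy) fun k l n => ?_)
  have := h (k, l, n)
  rw [← sub_eq_zero, ← map_sub, coef_apply] at this
  exact this

/-! ### Weighted `ℓ¹` norms of coefficients -/

/-- The weight `1 + k + l + |n|`. -/
def wt (κ : ℕ × ℕ × ℤ) : ℕ := 1 + κ.1 + κ.2.1 + κ.2.2.natAbs

/-- The weighted `ℓ¹` norm of the matrix coefficients. -/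
def JN (p : ℕ) (x : H →L[ℂ] H) : ENNReal := ∑' κ, ‖coef κ x‖ₑ * (wt κ : ENNReal) ^ p

/-- The weighted `ℓ¹` norm of a sequence indexed by `ℤ`. -/
def TN (p : ℕ) (φ : ℤ → ℂ) : ENNReal := ∑' n, ‖φ n‖ₑ * ((1 + n.natAbs : ℕ) : ENNReal) ^ p

/-- The Toeplitz operator with symbol `∑ φ_n ζ^n`. -/
def toep (φ : ℤ → ℂ) : H →L[ℂ] H := ∑' n, φ n • tau n

/-- The source of all submultiplicative weight estimates: indices add under multiplication of the
elementary operators. -/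
theorem le_one_add_mul_one_add {a b c : ℕ} (h : c ≤ 1 + a + b) : c ≤ (1 + a) * (1 + b) := by
  nlinarith [Nat.zero_le (a * b)]

theorem one_le_wt (κ : ℕ × ℕ × ℤ) : 1 ≤ wt κ := by
  unfold wt
  omega

/-- Each `coef κ` is continuous, so this is Tonelli. With values in `ENNReal` there is no
convergence to check on the right-hand side. -/
theorem JN_le_of_hasSum {ι : Type*} {X : ι → H →L[ℂ] H} {x : H →L[ℂ] H} (h : HasSum X x)
    (p : ℕ) : JN p x ≤ ∑' i, JN p (X i) := by
  calc JN p x ≤ ∑' κ, ∑' i, ‖coef κ (X i)‖ₑ * (wt κ : ENNReal) ^ p := by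
        refine ENNReal.tsum_le_tsum fun κ => ?_
        rw [← (h.mapL (coef κ)).tsum_eq, ENNReal.tsum_mul_right]
        gcongr
        exact enorm_tsum_le_tsum_enorm
    _ = ∑' i, JN p (X i) := ENNReal.tsum_comm

theorem JN_add (p : ℕ) (x y : H →L[ℂ] H) : JN p (x + y) ≤ JN p x + JN p y := by
  rw [JN, JN, JN, ← ENNReal.tsum_add]
  refine ENNReal.tsum_le_tsum fun κ => ?_
  rw [map_add, ← add_mul]
  gcongr
  exact enorm_add_le _ _

theorem JN_smul (p : ℕ) (c : ℂ) (x : H →L[ℂ] H) : JN p (c • x) = ‖c‖ₑ * JN p x := by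
  rw [JN, JN, ← ENNReal.tsum_mul_left]
  refine tsum_congr fun κ => ?_
  rw [map_smul, smul_eq_mul, enorm_mul, mul_assoc]

theorem JN_zero (p : ℕ) : JN p 0 = 0 := by simp [JN]

theorem JN_neg (p : ℕ) (x : H →L[ℂ] H) : JN p (-x) = JN p x := by simp [JN]

theorem JN_sum {ι : Type*} (p : ℕ) (s : Finset ι) (X : ι → H →L[ℂ] H) :
    JN p (∑ i ∈ s, X i) ≤ ∑ i ∈ s, JN p (X i) := by
  classical
  induction s using Finset.induction_on with
  | empty => simp [JN_zero]
  | insert i s hi ih =>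
    rw [Finset.sum_insert hi, Finset.sum_insert hi]
    exact (JN_add p _ _).trans (by gcongr)

theorem JN_cell (p : ℕ) (κ : ℕ × ℕ × ℤ) : JN p (cell κ) = (wt κ : ENNReal) ^ p := by
  rw [JN, tsum_eq_single κ]
  · simp [coef_cell]
  · intro κ' h
    simp [coef_cell, h]

theorem mem_of_hasSum {S : StarSubalgebra ℂ (H →L[ℂ] H)} (hS : IsClosed (S : Set (H →L[ℂ] H)))
    {ι : Type*} {X : ι → H →L[ℂ] H} {x : H →L[ℂ] H} (h : HasSum X x) (hX : ∀ i, X i ∈ S) :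
    x ∈ S :=
  hS.mem_of_tendsto h (Filter.Eventually.of_forall fun _ => sum_mem fun i _ => hX i)

theorem summable_smul_of_enorm {ι : Type*} {c : ι → ℂ} {X : ι → H →L[ℂ] H}
    (hc : ∑' i, ‖c i‖ₑ ≠ ⊤) (hX : ∀ i, ‖X i‖ ≤ 1) : Summable fun i => c i • X i := by
  refine Summable.of_norm_bounded (tsum_enorm_ne_top_iff_summable_norm.1 hc) fun i => ?_
  rw [norm_smul]
  exact mul_le_of_le_one_right (norm_nonneg _) (hX i)

theorem cell_mem_commA (κ : ℕ × ℕ × ℤ) : cell κ ∈ commA := cstarA_le_commA (cell_mem_cstarA κ)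

theorem coef_of_hasSum_cell {c : ℕ × ℕ × ℤ → ℂ} {x : H →L[ℂ] H}
    (h : HasSum (fun κ => c κ • cell κ) x) (κ : ℕ × ℕ × ℤ) : coef κ x = c κ := by
  refine (h.mapL (coef κ)).unique ?_
  convert hasSum_ite_eq κ (c κ) using 2 with κ'
  rw [map_smul, coef_cell, smul_eq_mul, mul_ite, mul_one, mul_zero]
  by_cases h : κ = κ'
  · simp [h]
  · simp [h, Ne.symm h]

/-- Finiteness of `JN 0` makes the expansion converge absolutely, since cells are contractions. Its
sum lies in the commutant and has the same coefficients as x, and coefficients separate elements of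
the commutant. -/
theorem hasSum_cell {x : H →L[ℂ] H} (hx : x ∈ commA) (h : JN 0 x ≠ ⊤) :
    HasSum (fun κ => coef κ x • cell κ) x := by
  have hs : HasSum (fun κ => coef κ x • cell κ) _ :=
    (summable_smul_of_enorm (by simpa [JN] using h) norm_cell_le).hasSum
  convert hs
  refine eq_of_coef hx ?_ fun κ => (coef_of_hasSum_cell hs κ).symm
  exact mem_of_hasSum isClosed_commA hs fun κ => commA.smul_mem (cell_mem_commA κ) _

theorem hasSum_toep {φ : ℤ → ℂ} (h : TN 0 φ ≠ ⊤) : HasSum (fun n => φ n • tau n) (toep φ) :=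
  (summable_smul_of_enorm (by simpa [TN] using h) norm_tau_le).hasSum

theorem toep_mem_cstarA (φ : ℤ → ℂ) : toep φ ∈ cstarA := by
  by_cases h : Summable fun n => φ n • tau n
  · exact mem_of_hasSum isClosed_cstarA h.hasSum fun n => cstarA.smul_mem (tau_mem_cstarA n) _
  · rw [toep, tsum_eq_zero_of_not_summable h]
    exact zero_mem _

theorem toep_mem_commA (φ : ℤ → ℂ) : toep φ ∈ commA := cstarA_le_commA (toep_mem_cstarA φ)

/-- Weighted ℓ¹ bounds need only be tested on cells. Taking for L a left or right multiplication
reduces product estimates to the multiplication table. -/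
theorem JN_map_le (L : (H →L[ℂ] H) →L[ℂ] (H →L[ℂ] H)) {p q : ℕ} {A : ENNReal}
    (hL : ∀ κ, JN p (L (cell κ)) ≤ A * (wt κ : ENNReal) ^ q) {x : H →L[ℂ] H} (hx : x ∈ commA)
    (h : JN 0 x ≠ ⊤) : JN p (L x) ≤ A * JN q x := by
  refine (JN_le_of_hasSum ((hasSum_cell hx h).mapL L) p).trans ?_
  rw [JN, ← ENNReal.tsum_mul_left]
  refine ENNReal.tsum_le_tsum fun κ => ?_
  rw [map_smul, JN_smul, mul_left_comm]
  gcongr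
  exact hL κ

theorem JN_map_toep_le (L : (H →L[ℂ] H) →L[ℂ] (H →L[ℂ] H)) {p q : ℕ} {A : ENNReal}
    (hL : ∀ n, JN p (L (tau n)) ≤ A * ((1 + n.natAbs : ℕ) : ENNReal) ^ q) {φ : ℤ → ℂ}
    (h : TN 0 φ ≠ ⊤) : JN p (L (toep φ)) ≤ A * TN q φ := by
  refine (JN_le_of_hasSum ((hasSum_toep h).mapL L) p).trans ?_
  rw [TN, ← ENNReal.tsum_mul_left]
  refine ENNReal.tsum_le_tsum fun n => ?_
  rw [map_smul, JN_smul, mul_left_comm]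
  gcongr
  exact hL n

/-- Left multiplication as a continuous linear map. -/
abbrev mulL (x : H →L[ℂ] H) : (H →L[ℂ] H) →L[ℂ] (H →L[ℂ] H) := ContinuousLinearMap.mul ℂ _ x

/-- Right multiplication as a continuous linear map. -/
abbrev mulR (x : H →L[ℂ] H) : (H →L[ℂ] H) →L[ℂ] (H →L[ℂ] H) :=
  (ContinuousLinearMap.mul ℂ _).flip x

theorem JN_cell_mul_cell_le (p : ℕ) (κ κ' : ℕ × ℕ × ℤ) :
    JN p (cell κ * cell κ') ≤ (wt κ : ENNReal) ^ p * (wt κ' : ENNReal) ^ p := by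
  rw [cell_mul_cell]
  split_ifs
  · rw [JN_cell, ← mul_pow]
    gcongr
    norm_cast
    obtain ⟨k, l, n⟩ := κ
    obtain ⟨k', l', n'⟩ := κ'
    have := Int.natAbs_add_le n n'
    simp only [wt, add_assoc 1]
    exact le_one_add_mul_one_add (by omega)
  · rw [JN_zero]
    exact zero_le

theorem JN_tau_mul_cell_le (p : ℕ) (j : ℤ) (κ : ℕ × ℕ × ℤ) :
    JN p (tau j * cell κ) ≤ ((1 + j.natAbs : ℕ) : ENNReal) ^ p * (wt κ : ENNReal) ^ p := by
  rw [tau_mul_cell]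
  split_ifs
  · rw [JN_cell, ← mul_pow]
    gcongr
    norm_cast
    obtain ⟨k, l, n⟩ := κ
    simp only [wt, add_assoc 1]
    exact le_one_add_mul_one_add (by omega)
  · rw [JN_zero]
    exact zero_le

theorem JN_cell_mul_tau_le (p : ℕ) (j : ℤ) (κ : ℕ × ℕ × ℤ) :
    JN p (cell κ * tau j) ≤ ((1 + j.natAbs : ℕ) : ENNReal) ^ p * (wt κ : ENNReal) ^ p := by
  rw [cell_mul_tau]
  split_ifs
  · rw [JN_cell, ← mul_pow]
    gcongr
    norm_cast
    obtain ⟨k, l, n⟩ := κ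
    simp only [wt, add_assoc 1]
    exact le_one_add_mul_one_add (by omega)
  · rw [JN_zero]
    exact zero_le

/-- The defect has at most j cells, each of weight at most (1 + |i|)(1 + |j|). Their number costs
the extra power. -/
theorem JN_tau_mul_tau_sub_le (p : ℕ) (i j : ℤ) :
    JN p (tau i * tau j - tau (i + j)) ≤
      ((1 + i.natAbs : ℕ) : ENNReal) ^ (p + 1) * ((1 + j.natAbs : ℕ) : ENNReal) ^ (p + 1) := by
  rw [tau_mul_tau, sub_sub_cancel_left, JN_neg]
  have hterm : ∀ k ∈ (Finset.range j.toNat).filter fun k => i + j ≤ (k : ℕ),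
      JN p (cell ((k - i - j).toNat, k, 0)) ≤
        ((1 + i.natAbs : ℕ) : ENNReal) ^ p * ((1 + j.natAbs : ℕ) : ENNReal) ^ p := by
    intro k hk
    rw [Finset.mem_filter, Finset.mem_range] at hk
    rw [JN_cell, ← mul_pow]
    gcongr
    norm_cast
    simp only [wt, Int.natAbs_zero]
    exact le_one_add_mul_one_add (by omega)
  refine (JN_sum p _ _).trans ((Finset.sum_le_card_nsmul _ _ _ hterm).trans ?_)
  rw [nsmul_eq_mul, pow_succ, pow_succ]
  have hcard : ((Finset.range j.toNat).filter fun k => i + j ≤ (k : ℕ)).card ≤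
      (1 + i.natAbs) * (1 + j.natAbs) := by
    refine (Finset.card_filter_le _ _).trans ?_
    rw [Finset.card_range]
    exact le_one_add_mul_one_add (by omega)
  calc _ ≤ (((1 + i.natAbs) * (1 + j.natAbs) : ℕ) : ENNReal) *
        (((1 + i.natAbs : ℕ) : ENNReal) ^ p * ((1 + j.natAbs : ℕ) : ENNReal) ^ p) := by
        gcongr
    _ = _ := by
        push_cast
        ring

theorem JN_mul_le (p : ℕ) {x y : H →L[ℂ] H} (hx : x ∈ commA) (hy : y ∈ commA)
    (hx0 : JN 0 x ≠ ⊤) (hy0 : JN 0 y ≠ ⊤) : JN p (x * y) ≤ JN p x * JN p y := by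
  rw [mul_comm]
  refine JN_map_le (mulR y) (fun κ => ?_) hx hx0
  rw [mul_comm]
  exact JN_map_le (mulL (cell κ)) (JN_cell_mul_cell_le p κ) hy hy0

theorem JN_toep_mul_le (p : ℕ) {φ : ℤ → ℂ} {x : H →L[ℂ] H} (hφ : TN 0 φ ≠ ⊤) (hx : x ∈ commA)
    (hx0 : JN 0 x ≠ ⊤) : JN p (toep φ * x) ≤ TN p φ * JN p x := by
  rw [mul_comm]
  refine JN_map_toep_le (mulR x) (fun n => ?_) hφ
  rw [mul_comm]
  exact JN_map_le (mulL (tau n)) (JN_tau_mul_cell_le p n) hx hx0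

theorem JN_mul_toep_le (p : ℕ) {φ : ℤ → ℂ} {x : H →L[ℂ] H} (hφ : TN 0 φ ≠ ⊤) (hx : x ∈ commA)
    (hx0 : JN 0 x ≠ ⊤) : JN p (x * toep φ) ≤ TN p φ * JN p x := by
  rw [mul_comm]
  refine JN_map_toep_le (mulL x) (fun n => ?_) hφ
  rw [mul_comm]
  exact JN_map_le (mulR (tau n)) (JN_cell_mul_tau_le p n) hx hx0

/-- Convolution of sequences indexed by `ℤ`. -/
def conv (φ ψ : ℤ → ℂ) (n : ℤ) : ℂ := ∑' i, φ i * ψ (n - i)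

theorem TN_conv_le (p : ℕ) (φ ψ : ℤ → ℂ) : TN p (conv φ ψ) ≤ TN p φ * TN p ψ := by
  calc TN p (conv φ ψ)
      ≤ ∑' n, ∑' i, (‖φ i‖ₑ * ‖ψ (n - i)‖ₑ) * ((1 + n.natAbs : ℕ) : ENNReal) ^ p := by
        refine ENNReal.tsum_le_tsum fun n => ?_
        rw [ENNReal.tsum_mul_right]
        gcongr
        refine enorm_tsum_le_tsum_enorm.trans_eq (tsum_congr fun i => enorm_mul _ _)
    _ ≤ ∑' n, ∑' i, (‖φ i‖ₑ * ((1 + i.natAbs : ℕ) : ENNReal) ^ p) *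
          (‖ψ (n - i)‖ₑ * ((1 + (n - i).natAbs : ℕ) : ENNReal) ^ p) := by
        refine ENNReal.tsum_le_tsum fun n => ENNReal.tsum_le_tsum fun i => ?_
        rw [mul_mul_mul_comm, ← mul_pow]
        gcongr
        norm_cast
        exact le_one_add_mul_one_add (by omega)
    _ = TN p φ * TN p ψ := by
        rw [ENNReal.tsum_comm, TN, ← ENNReal.tsum_mul_right]
        refine tsum_congr fun i => ?_
        rw [ENNReal.tsum_mul_left]
        congr 1
        exact (Equiv.subRight i).tsum_eq fun n => ‖ψ n‖ₑ * ((1 + n.natAbs : ℕ) : ENNReal) ^ p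

theorem summable_norm_of_TN {φ : ℤ → ℂ} (h : TN 0 φ ≠ ⊤) : Summable fun n => ‖φ n‖ :=
  tsum_enorm_ne_top_iff_summable_norm.1 (by simpa [TN] using h)

theorem hasSum_toep_conv {φ ψ : ℤ → ℂ} (hφ : TN 0 φ ≠ ⊤) (hψ : TN 0 ψ ≠ ⊤) :
    HasSum (fun q : ℤ × ℤ => (φ q.1 * ψ q.2) • tau (q.1 + q.2)) (toep (conv φ ψ)) := by
  have h1 : Summable fun q : ℤ × ℤ => ‖φ q.1 * ψ q.2‖ :=
    (summable_norm_of_TN hφ).mul_norm (summable_norm_of_TN hψ)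
  have h2 : Summable fun q : ℤ × ℤ => (φ q.1 * ψ q.2) • tau (q.1 + q.2) :=
    summable_smul_of_enorm (tsum_enorm_ne_top_iff_summable_norm.2 h1) fun _ => norm_tau_le _
  -- The shear (n, i) ↦ (i, n - i) groups the double series by total degree n.
  let E : ℤ × ℤ ≃ ℤ × ℤ :=
    ⟨fun q => (q.2, q.1 - q.2), fun q => (q.1 + q.2, q.1), fun q => by simp, fun q => by simp⟩
  have h3 : HasSum (fun q : ℤ × ℤ => (φ q.2 * ψ (q.1 - q.2)) • tau q.1)
      (∑' q : ℤ × ℤ, (φ q.1 * ψ q.2) • tau (q.1 + q.2)) := by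
    have := (E.hasSum_iff).2 h2.hasSum
    convert this using 2 with q
    simp [E]
  have h4 : Summable fun q : ℤ × ℤ => φ q.2 * ψ (q.1 - q.2) :=
    (E.summable_iff).2 h1.of_norm
  have h5 : HasSum (fun n => conv φ ψ n • tau n)
      (∑' q : ℤ × ℤ, (φ q.1 * ψ q.2) • tau (q.1 + q.2)) :=
    h3.prod_fiberwise fun n => (h4.prod_factor n).hasSum.smul_const (tau n)
  rw [toep, h5.tsum_eq]
  exact h2.hasSum

/-- Both operators are expanded over the same index set ℤ × ℤ, so that the defects `tau i * tau j -
tau (i + j)` can be summed term by term. -/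
theorem JN_toep_mul_toep_le (p : ℕ) {φ ψ : ℤ → ℂ} (hφ : TN 0 φ ≠ ⊤) (hψ : TN 0 ψ ≠ ⊤) :
    JN p (toep φ * toep ψ - toep (conv φ ψ)) ≤ TN (p + 1) φ * TN (p + 1) ψ := by
  have h1 : HasSum (fun q : ℤ × ℤ => (φ q.1 * ψ q.2) • (tau q.1 * tau q.2))
      (toep φ * toep ψ) := by
    have hs := ((summable_norm_of_TN hφ).mul_norm (summable_norm_of_TN hψ))
    have := (hasSum_toep hφ).mul (hasSum_toep hψ) (by
      simp only [smul_mul_smul_comm]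
      exact summable_smul_of_enorm (tsum_enorm_ne_top_iff_summable_norm.2 hs)
        fun _ => norm_mul_le_one (norm_tau_le _) (norm_tau_le _))
    simpa only [smul_mul_smul_comm] using this
  have h2 := h1.sub (hasSum_toep_conv hφ hψ)
  refine (JN_le_of_hasSum h2 p).trans ?_
  rw [ENNReal.tsum_prod (f := fun i j => JN p ((φ i * ψ j) • (tau i * tau j) -
    (φ i * ψ j) • tau (i + j))), TN, TN, ← ENNReal.tsum_mul_right]
  refine ENNReal.tsum_le_tsum fun i => ?_
  rw [← ENNReal.tsum_mul_left]
  refine ENNReal.tsum_le_tsum fun j => ?_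
  rw [← smul_sub, JN_smul, enorm_mul, mul_mul_mul_comm]
  gcongr
  exact JN_tau_mul_tau_sub_le p i j

/-! ### Uniformly smooth families of functions of a real variable -/

section UniformlySmooth

variable {ι ι' : Type*} {E F : Type*} [NormedAddCommGroup E] [NormedSpace ℝ E]
  [NormedAddCommGroup F] [NormedSpace ℝ F] {R : Type*} [NormedRing R] [NormedAlgebra ℝ R]

/-- The functions `G t` have bounded derivatives up to order `m`, uniformly in `t`. -/
def UBd : ℕ → (ι → ℝ → E) → Prop
  | 0, G => (∀ t, Continuous (G t)) ∧ ∃ C, ∀ t θ, ‖G t θ‖ ≤ C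
  | m + 1, G => (∃ C, ∀ t θ, ‖G t θ‖ ≤ C) ∧
      ∃ G' : ι → ℝ → E, (∀ t θ, HasDerivAt (G t) (G' t θ) θ) ∧ UBd m G'

theorem UBd.bdd {m : ℕ} {G : ι → ℝ → E} (h : UBd m G) : ∃ C, ∀ t θ, ‖G t θ‖ ≤ C := by
  cases m with
  | zero => exact h.2
  | succ m => exact h.1

theorem UBd.continuous {m : ℕ} {G : ι → ℝ → E} (h : UBd m G) (t : ι) : Continuous (G t) := by
  cases m with
  | zero => exact h.1 t
  | succ m =>
    obtain ⟨-, G', hG', -⟩ := h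
    exact continuous_iff_continuousAt.2 fun θ => (hG' t θ).continuousAt

theorem UBd.of_succ {m : ℕ} {G : ι → ℝ → E} (h : UBd (m + 1) G) : UBd m G := by
  induction m generalizing G with
  | zero => exact ⟨h.continuous, h.1⟩
  | succ m ih =>
    obtain ⟨h1, G', hG', h2⟩ := h
    exact ⟨h1, G', hG', ih h2⟩

theorem uBd_const {f : ι → E} {C : ℝ}
    (hf : ∀ t, ‖f t‖ ≤ C) (m : ℕ) : UBd m fun (t : ι) (_ : ℝ) => f t := by
  induction m generalizing f C with
  | zero => exact ⟨fun _ => continuous_const, C, fun t _ => hf t⟩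
  | succ m ih =>
    exact ⟨⟨C, fun t _ => hf t⟩, fun _ _ => 0, fun t θ => hasDerivAt_const θ (f t),
      ih (f := fun _ => 0) (C := 0) (by simp)⟩

theorem UBd.add {m : ℕ} {G K : ι → ℝ → E} (hG : UBd m G) (hK : UBd m K) :
    UBd m fun t θ => G t θ + K t θ := by
  induction m generalizing G K with
  | zero =>
    obtain ⟨C, hC⟩ := hG.2
    obtain ⟨D, hD⟩ := hK.2
    exact ⟨fun t => (hG.1 t).add (hK.1 t), C + D, fun t θ => norm_add_le_of_le (hC t θ) (hD t θ)⟩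
  | succ m ih =>
    obtain ⟨⟨C, hC⟩, G', hG', h1⟩ := hG
    obtain ⟨⟨D, hD⟩, K', hK', h2⟩ := hK
    exact ⟨⟨C + D, fun t θ => norm_add_le_of_le (hC t θ) (hD t θ)⟩, _,
      fun t θ => (hG' t θ).add (hK' t θ), ih h1 h2⟩

/-- The reindexing r allows one operator-valued family to be replaced by the family of all its
matrix coefficients, with bounds uniform in their indices. -/
theorem UBd.map {m : ℕ} {G : ι → ℝ → E} (hG : UBd m G) (r : ι' → ι) (L : ι' → E →L[ℝ] F) {D : ℝ}
    (hL : ∀ s, ‖L s‖ ≤ D) : UBd m fun s θ => L s (G (r s) θ) := by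
  have hb : ∀ {G : ι → ℝ → E} {C : ℝ}, (∀ t θ, ‖G t θ‖ ≤ C) → ∀ s θ, ‖L s (G (r s) θ)‖ ≤ D * C :=
    fun h s θ => ((L s).le_opNorm _).trans
      (mul_le_mul (hL s) (h _ _) (norm_nonneg _) ((norm_nonneg _).trans (hL s)))
  induction m generalizing G with
  | zero =>
    obtain ⟨C, hC⟩ := hG.2
    exact ⟨fun s => (L s).continuous.comp (hG.1 _), _, hb hC⟩
  | succ m ih =>
    obtain ⟨⟨C, hC⟩, G', hG', h1⟩ := hG
    exact ⟨⟨_, hb hC⟩, fun s θ => L s (G' (r s) θ),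
      fun s θ => (L s).hasFDerivAt.comp_hasDerivAt θ (hG' (r s) θ), ih h1⟩

theorem UBd.neg {m : ℕ} {G : ι → ℝ → E} (hG : UBd m G) : UBd m fun t θ => -G t θ := by
  simpa using hG.map id (fun _ => -ContinuousLinearMap.id ℝ E) (D := 1)
    fun _ => by rw [norm_neg]; exact ContinuousLinearMap.norm_id_le

theorem UBd.mul {m : ℕ} {G K : ι → ℝ → R} (hG : UBd m G) (hK : UBd m K) :
    UBd m fun t θ => G t θ * K t θ := by
  have hb : ∀ {G K : ι → ℝ → R} {C D : ℝ}, (∀ t θ, ‖G t θ‖ ≤ C) → (∀ t θ, ‖K t θ‖ ≤ D) →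
      ∀ t θ, ‖G t θ * K t θ‖ ≤ C * D := fun h1 h2 t θ => (norm_mul_le _ _).trans
    (mul_le_mul (h1 t θ) (h2 t θ) (norm_nonneg _) ((norm_nonneg _).trans (h1 t θ)))
  induction m generalizing G K with
  | zero =>
    obtain ⟨C, hC⟩ := hG.2
    obtain ⟨D, hD⟩ := hK.2
    exact ⟨fun t => (hG.1 t).mul (hK.1 t), _, hb hC hD⟩
  | succ m ih =>
    have hG0 := hG.of_succ
    have hK0 := hK.of_succ
    obtain ⟨⟨C, hC⟩, G', hG', h1⟩ := hG
    obtain ⟨⟨D, hD⟩, K', hK', h2⟩ := hK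
    exact ⟨⟨_, hb hC hD⟩, _, fun t θ => (hG' t θ).mul (hK' t θ), (ih h1 hK0).add (ih hG0 h2)⟩

/-- Uniform smoothness passes to inverses, provided that these are uniformly bounded. -/
theorem UBd.inverse [CompleteSpace R] {m : ℕ} {G K : ι → ℝ → R} (hG : UBd m G)
    (h1 : ∀ t θ, G t θ * K t θ = 1) (h2 : ∀ t θ, K t θ * G t θ = 1) {C : ℝ}
    (hK : ∀ t θ, ‖K t θ‖ ≤ C) : UBd m K := by
  let u : ι → ℝ → Rˣ := fun t θ => ⟨G t θ, K t θ, h1 t θ, h2 t θ⟩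
  -- Continuity and differentiability of K come from those of inversion at units.
  have hKi : ∀ t, K t = fun θ => Ring.inverse (G t θ) := fun t => by
    ext θ
    exact (Ring.inverse_unit (u t θ)).symm
  induction m with
  | zero =>
    refine ⟨fun t => ?_, C, hK⟩
    rw [hKi, continuous_iff_continuousAt]
    exact fun θ => ContinuousAt.comp (f := G t) (NormedRing.inverse_continuousAt (u t θ))
      (hG.1 t).continuousAt
  | succ m ih =>
    have hKm := ih hG.of_succ
    obtain ⟨-, G', hG', h3⟩ := hG
    -- The derivative -K G' K involves only K and G' up to order m, which the induction already
    -- controls.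
    refine ⟨⟨C, hK⟩, fun t θ => -(K t θ * G' t θ * K t θ), fun t θ => ?_, ?_⟩
    · have := HasFDerivAt.comp_hasDerivAt (f := G t) θ (hasFDerivAt_ringInverse (𝕜 := ℝ) (u t θ))
        (hG' t θ)
      rw [hKi]
      exact this
    · exact ((hKm.mul h3).mul hKm).neg

theorem UBd.of_contDiff {G : ι → ℝ → E} (hG : ∀ t, ContDiff ℝ ∞ (G t))
    (hb : ∀ m, ∃ C, ∀ t θ, ‖iteratedDeriv m (G t) θ‖ ≤ C) (m : ℕ) : UBd m G := by
  induction m generalizing G with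
  | zero => exact ⟨fun t => (hG t).continuous, by simpa using hb 0⟩
  | succ m ih =>
    refine ⟨by simpa using hb 0, fun t => deriv (G t),
      fun t θ => ((hG t).differentiable (by simp) θ).hasDerivAt,
      ih (fun t => (contDiff_infty_iff_deriv.1 (hG t)).2) fun q => ?_⟩
    simpa only [← iteratedDeriv_succ'] using hb (q + 1)

/-- The character `θ ↦ exp (i n θ)`. -/
def chr (n : ℤ) (θ : ℝ) : ℂ := Complex.exp (Complex.I * n * θ)

theorem norm_chr (n : ℤ) (θ : ℝ) : ‖chr n θ‖ = 1 := by
  rw [chr, show Complex.I * n * θ = ((n * θ : ℝ) : ℂ) * Complex.I by push_cast; ring,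
    Complex.norm_exp_ofReal_mul_I]

theorem hasDerivAt_chr (n : ℤ) (θ : ℝ) : HasDerivAt (chr n) (Complex.I * n * chr n θ) θ := by
  have h : HasDerivAt (fun θ : ℝ => Complex.I * n * (θ : ℂ)) (Complex.I * n) θ := by
    simpa using (Complex.ofRealCLM.hasDerivAt (x := θ)).const_mul (Complex.I * n)
  have := h.cexp
  rw [mul_comm (Complex.exp _)] at this
  exact this

theorem chr_zero_right (n : ℤ) : chr n 0 = 1 := by simp [chr]

theorem chr_add (n m : ℤ) (θ : ℝ) : chr (n + m) θ = chr n θ * chr m θ := by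
  rw [chr, chr, chr, ← Complex.exp_add]
  congr 1
  push_cast
  ring

/-- If the functions `c_t exp(i n_t θ)` are uniformly smooth then `|n_t|^m |c_t|` is bounded. -/
theorem UBd.bound_of_chr {m : ℕ} {c : ι → ℂ} {n : ι → ℤ}
    (h : UBd m fun t θ => c t * chr (n t) θ) : ∃ C, ∀ t, |(n t : ℝ)| ^ m * ‖c t‖ ≤ C := by
  induction m generalizing c with
  | zero =>
    obtain ⟨C, hC⟩ := h.2
    exact ⟨C, fun t => by simpa [chr_zero_right] using hC t 0⟩
  | succ m ih =>
    obtain ⟨-, G', hG', h1⟩ := h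
    have : G' = fun t θ => (c t * (Complex.I * n t)) * chr (n t) θ := by
      ext t θ
      rw [mul_assoc]
      exact (hG' t θ).unique ((hasDerivAt_chr (n t) θ).const_mul (c t))
    rw [this] at h1
    obtain ⟨C, hC⟩ := ih h1
    refine ⟨C, fun t => (hC t).trans_eq' ?_⟩
    simp only [norm_mul, Complex.norm_I, one_mul, Complex.norm_intCast]
    ring

end UniformlySmooth

/-! ### Exponential sums -/

section ExpSum

variable {K : Type*} {E : Type*} [NormedAddCommGroup E] [NormedSpace ℂ E]

/-- The function `θ ↦ ∑ c_κ exp(i n_κ θ) X_κ`. -/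
def expSum (c : K → ℂ) (n : K → ℤ) (X : K → E) (θ : ℝ) : E := ∑' κ, (c κ * chr (n κ) θ) • X κ

variable {c : K → ℂ} {n : K → ℤ} {X : K → E}

theorem norm_expSum_term_le (hX : ∀ κ, ‖X κ‖ ≤ 1) (κ : K) (θ : ℝ) :
    ‖(c κ * chr (n κ) θ) • X κ‖ ≤ ‖c κ‖ := by
  rw [norm_smul, norm_mul, norm_chr, mul_one]
  exact mul_le_of_le_one_right (norm_nonneg _) (hX κ)

theorem norm_expSum_le (hc : Summable fun κ => ‖c κ‖) (hX : ∀ κ, ‖X κ‖ ≤ 1) (θ : ℝ) :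
    ‖expSum c n X θ‖ ≤ ∑' κ, ‖c κ‖ :=
  tsum_of_norm_bounded hc.hasSum fun κ => norm_expSum_term_le hX κ θ

variable [CompleteSpace E]

theorem hasSum_expSum (hc : Summable fun κ => ‖c κ‖) (hX : ∀ κ, ‖X κ‖ ≤ 1) (θ : ℝ) :
    HasSum (fun κ => (c κ * chr (n κ) θ) • X κ) (expSum c n X θ) :=
  (Summable.of_norm_bounded hc fun κ => norm_expSum_term_le hX κ θ).hasSum

theorem hasDerivAt_expSum (hc : Summable fun κ => ‖c κ‖)
    (hc1 : Summable fun κ => ‖c κ * (Complex.I * n κ)‖) (hX : ∀ κ, ‖X κ‖ ≤ 1) (θ : ℝ) :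
    HasDerivAt (expSum c n X) (expSum (fun κ => c κ * (Complex.I * n κ)) n X θ) θ := by
  refine hasDerivAt_tsum (g := fun κ θ => (c κ * chr (n κ) θ) • X κ)
    (g' := fun κ θ => (c κ * (Complex.I * n κ) * chr (n κ) θ) • X κ) hc1 (fun κ y => ?_)
    (fun κ y => norm_expSum_term_le (c := fun κ => c κ * (Complex.I * n κ)) hX κ y) (y₀ := 0)
    (Summable.of_norm_bounded hc fun κ => norm_expSum_term_le hX κ 0) θ
  rw [mul_assoc]
  exact ((hasDerivAt_chr (n κ) y).const_mul (c κ)).smul_const (X κ)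

/-- All moments of `c` with respect to `n` are summable. -/
def Moments (c : K → ℂ) (n : K → ℤ) : Prop := ∀ p : ℕ, Summable fun κ => |(n κ : ℝ)| ^ p * ‖c κ‖

theorem Moments.summable (h : Moments c n) : Summable fun κ => ‖c κ‖ := by simpa using h 0

theorem Moments.mul (h : Moments c n) : Moments (fun κ => c κ * (Complex.I * n κ)) n := fun p => by
  refine (h (p + 1)).congr fun κ => ?_
  simp only [norm_mul, Complex.norm_I, one_mul, Complex.norm_intCast]
  ring

/-- Termwise differentiation multiplies the coefficients by i n, and this preserves summability of
all moments. -/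
theorem Moments.uBd {ι : Type*} (h : Moments c n) (hX : ∀ κ, ‖X κ‖ ≤ 1) (m : ℕ) :
    UBd m fun _ : ι => expSum c n X := by
  induction m generalizing c with
  | zero =>
    exact ⟨fun _ => continuous_iff_continuousAt.2 fun θ =>
      (hasDerivAt_expSum h.summable h.mul.summable hX θ).continuousAt, _,
      fun _ => norm_expSum_le h.summable hX⟩
  | succ m ih =>
    exact ⟨⟨_, fun _ => norm_expSum_le h.summable hX⟩, _,
      fun _ θ => hasDerivAt_expSum h.summable h.mul.summable hX θ, ih h.mul⟩

theorem Moments.iteratedDeriv (h : Moments c n) (hX : ∀ κ, ‖X κ‖ ≤ 1) (m : ℕ) :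
    iteratedDeriv m (expSum c n X) = expSum (fun κ => c κ * (Complex.I * n κ) ^ m) n X := by
  induction m generalizing c with
  | zero => simp
  | succ m ih =>
    rw [iteratedDeriv_succ', show deriv (expSum c n X) = _ from
      funext fun θ => (hasDerivAt_expSum h.summable h.mul.summable hX θ).deriv, ih h.mul]
    simp only [pow_succ', mul_assoc]

theorem Moments.contDiff (h : Moments c n) (hX : ∀ κ, ‖X κ‖ ≤ 1) :
    ContDiff ℝ ∞ (expSum c n X) := by
  have hp : ∀ m : ℕ, Moments (fun κ => c κ * (Complex.I * n κ) ^ m) n := fun m => by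
    induction m with
    | zero => simpa using h
    | succ m ih =>
      have := ih.mul
      simpa only [pow_succ, mul_assoc] using this
  refine contDiff_of_differentiable_iteratedDeriv fun m _ => ?_
  rw [h.iteratedDeriv hX]
  exact fun θ => (hasDerivAt_expSum (hp m).summable (hp m).mul.summable hX θ).differentiableAt

end ExpSum

/-! ### Fourier coefficients of smooth functions -/

theorem fourierCoeffOn_two_pi (f : ℝ → ℂ) (n : ℤ) : fourierCoeffOn Real.two_pi_pos f n =
    (1 / (2 * Real.pi)) • ∫ θ in (0 : ℝ)..(2 * Real.pi), chr (-n) θ * f θ := by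
  rw [fourierCoeffOn_eq_integral, sub_zero]
  congr 1
  refine intervalIntegral.integral_congr fun θ _ => ?_
  simp only [smul_eq_mul]
  congr 1
  rw [fourier_coe_apply, chr]
  congr 1
  have : (Real.pi : ℂ) ≠ 0 := by exact_mod_cast Real.pi_ne_zero
  push_cast
  field_simp

theorem continuous_chr (n : ℤ) : Continuous (chr n) :=
  continuous_iff_continuousAt.2 fun θ => (hasDerivAt_chr n θ).continuousAt

theorem periodic_chr (n : ℤ) : Function.Periodic (chr n) (2 * Real.pi) := fun θ => by
  rw [chr, chr, Complex.exp_eq_exp_iff_exists_int]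
  refine ⟨n, ?_⟩
  push_cast
  ring

theorem norm_fourierCoeffOn_le {f : ℝ → ℂ} {C : ℝ} (hf : ∀ θ, ‖f θ‖ ≤ C) (n : ℤ) :
    ‖fourierCoeffOn Real.two_pi_pos f n‖ ≤ C := by
  have hpi := Real.two_pi_pos
  rw [fourierCoeffOn_two_pi, norm_smul, Real.norm_of_nonneg (by positivity)]
  have := intervalIntegral.norm_integral_le_of_norm_le_const (a := 0) (b := 2 * Real.pi)
    (f := fun θ => chr (-n) θ * f θ) (C := C)
    fun θ _ => by rw [norm_mul, norm_chr, one_mul]; exact hf θ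
  rw [sub_zero, abs_of_pos hpi] at this
  calc _ ≤ 1 / (2 * Real.pi) * (C * (2 * Real.pi)) := by gcongr
    _ = C := by field_simp

/-- The first factor is an absolutely convergent exponential series, and it is integrated termwise
by dominated convergence. For g only continuity and boundedness matter, so no Fourier expansion of g
enters. -/
theorem hasSum_fourierCoeffOn_mul {c : ℤ → ℂ} (hc : Summable fun n => ‖c n‖) {g : ℝ → ℂ}
    (hg : Continuous g) {C : ℝ} (hC : ∀ θ, ‖g θ‖ ≤ C) (n : ℤ) :
    HasSum (fun k => c k * fourierCoeffOn Real.two_pi_pos g (n - k))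
      (fourierCoeffOn Real.two_pi_pos (fun θ => expSum c id (fun _ => (1 : ℂ)) θ * g θ) n) := by
  have hs : HasSum (fun k => ∫ θ in (0 : ℝ)..(2 * Real.pi), c k * (chr (-(n - k)) θ * g θ))
      (∫ θ in (0 : ℝ)..(2 * Real.pi),
        chr (-n) θ * (expSum c id (fun _ => (1 : ℂ)) θ * g θ)) := by
    refine intervalIntegral.hasSum_integral_of_dominated_convergence (fun k _ => ‖c k‖ * C)
      (fun k => ?_) (fun k => ?_) ?_ ?_ ?_
    · exact (continuous_const.mul ((continuous_chr _).mul hg)).aestronglyMeasurable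
    · refine Filter.Eventually.of_forall fun θ _ => ?_
      rw [norm_mul, norm_mul, norm_chr, one_mul]
      exact mul_le_mul_of_nonneg_left (hC θ) (norm_nonneg _)
    · exact Filter.Eventually.of_forall fun θ _ => hc.mul_right C
    · exact intervalIntegrable_const
    · refine Filter.Eventually.of_forall fun θ _ => ?_
      have := ((hasSum_expSum (n := id) (X := fun _ => (1 : ℂ)) hc (by simp) θ).mul_right
        (g θ)).mul_left (chr (-n) θ)
      have h : ∀ k, chr (-n) θ * ((c k * chr (id k) θ) • (1 : ℂ) * g θ) =
          c k * (chr (-(n - k)) θ * g θ) := fun k => by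
        rw [neg_sub, sub_eq_add_neg, chr_add, smul_eq_mul, id]
        ring
      simpa only [h] using this
  have := hs.const_smul (1 / (2 * Real.pi))
  rw [fourierCoeffOn_two_pi]
  convert this using 2 with k
  rw [fourierCoeffOn_two_pi, intervalIntegral.integral_const_mul, mul_smul_comm]

theorem fourierCoeffOn_one (n : ℤ) :
    fourierCoeffOn Real.two_pi_pos (fun _ => (1 : ℂ)) n = if n = 0 then 1 else 0 := by
  have hpi : (Real.pi : ℂ) ≠ 0 := by exact_mod_cast Real.pi_ne_zero
  split_ifs with h
  · subst h
    rw [fourierCoeffOn_two_pi]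
    simp [chr, mul_assoc]
  · rw [fourierCoeffOn_of_hasDerivAt Real.two_pi_pos h (f' := fun _ => 0)
      (fun θ _ => hasDerivAt_const θ _) intervalIntegrable_const]
    rw [fourierCoeffOn_two_pi (fun _ => 0)]
    simp

theorem fourierCoeffOn_expSum {c : ℤ → ℂ} (hc : Summable fun n => ‖c n‖) (n : ℤ) :
    fourierCoeffOn Real.two_pi_pos (expSum c id fun _ => (1 : ℂ)) n = c n := by
  have := hasSum_fourierCoeffOn_mul hc (g := fun _ => 1) continuous_const
    (C := 1) (by simp) n
  simp only [mul_one, fourierCoeffOn_one, mul_ite, mul_zero] at this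
  refine this.unique ?_
  convert hasSum_ite_eq n (c n) using 2 with k
  by_cases h : k = n
  · simp [h]
  · rw [if_neg h, if_neg (by omega)]

/-- Repeated integration by parts: periodicity removes the boundary terms, and each derivative gains
a factor n. -/
theorem UBd.fourier_bound {ι : Type*} {m : ℕ} {G : ι → ℝ → ℂ} (hG : UBd m G)
    (hp : ∀ t, Function.Periodic (G t) (2 * Real.pi)) :
    ∃ C, ∀ t (n : ℤ), |(n : ℝ)| ^ m * ‖fourierCoeffOn Real.two_pi_pos (G t) n‖ ≤ C := by
  induction m generalizing G with
  | zero =>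
    obtain ⟨C, hC⟩ := hG.2
    exact ⟨C, fun t n => by simpa using norm_fourierCoeffOn_le (hC t) n⟩
  | succ m ih =>
    obtain ⟨⟨D, hD⟩, G', hG', h1⟩ := hG
    have hp' : ∀ t, Function.Periodic (G' t) (2 * Real.pi) := fun t θ => by
      have := (hG' t (θ + 2 * Real.pi)).comp_add_const θ (2 * Real.pi)
      rw [funext (hp t)] at this
      exact this.unique (hG' t θ)
    obtain ⟨C, hC⟩ := ih h1 hp'
    refine ⟨max C 0, fun t n => ?_⟩
    by_cases hn : n = 0
    · simp [hn]
    · refine le_max_of_le_left ((hC t n).trans' ?_)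
      have hpi : (Real.pi : ℂ) ≠ 0 := by exact_mod_cast Real.pi_ne_zero
      have hn' : (n : ℂ) ≠ 0 := by exact_mod_cast hn
      have h0 : G t (2 * Real.pi) = G t 0 := by simpa using hp t 0
      rw [fourierCoeffOn_of_hasDerivAt Real.two_pi_pos hn (fun θ _ => hG' t θ)
        ((h1.continuous t).intervalIntegrable _ _), h0, sub_self, mul_zero, zero_sub]
      have : 1 / (-2 * Real.pi * Complex.I * n) * -(((2 * Real.pi : ℝ) - (0 : ℝ) : ℂ) *
          fourierCoeffOn Real.two_pi_pos (G' t) n) =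
          (Complex.I * n)⁻¹ * fourierCoeffOn Real.two_pi_pos (G' t) n := by
        push_cast
        field_simp
        simp
      rw [this, norm_mul, norm_inv, norm_mul, Complex.norm_I, one_mul, Complex.norm_intCast,
        pow_succ]
      have hn2 : |(n : ℝ)| ≠ 0 := by simpa using hn
      rw [mul_assoc, mul_inv_cancel_left₀ hn2]

/-! ### From pointwise bounds to weighted `ℓ¹` bounds -/

theorem enorm_mul_pow_le {E : Type*} [NormedAddCommGroup E] {x : E} {a q : ℕ} {C : ℝ}
    (h : (a : ℝ) ^ q * ‖x‖ ≤ C) : ‖x‖ₑ * (a : ENNReal) ^ q ≤ ENNReal.ofReal C := by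
  refine (ENNReal.ofReal_le_ofReal h).trans_eq' ?_
  rw [ENNReal.ofReal_mul (by positivity), ofReal_norm, ENNReal.ofReal_pow (by positivity),
    ENNReal.ofReal_natCast, mul_comm]

theorem tsum_nat_inv_sq_ne_top : ∑' k : ℕ, (((1 + k : ℕ) : ENNReal) ^ 2)⁻¹ ≠ ⊤ := by
  have h : Summable fun k : ℕ => (((1 + k : ℕ) : ℝ) ^ 2)⁻¹ := by
    have := (summable_nat_add_iff 1).2 (Real.summable_nat_pow_inv (p := 2).2 one_lt_two)
    simpa only [add_comm 1] using this
  convert h.tsum_ofReal_ne_top using 3 with k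
  rw [ENNReal.ofReal_inv_of_pos (by positivity), ENNReal.ofReal_pow (by positivity),
    ENNReal.ofReal_natCast]

theorem tsum_int_inv_sq_ne_top : ∑' n : ℤ, (((1 + n.natAbs : ℕ) : ENNReal) ^ 2)⁻¹ ≠ ⊤ := by
  have h : Summable fun k : ℕ => (((1 + k : ℕ) : ℝ) ^ 2)⁻¹ := by
    have := (summable_nat_add_iff 1).2 (Real.summable_nat_pow_inv (p := 2).2 one_lt_two)
    simpa only [add_comm 1] using this
  have h2 : Summable fun n : ℤ => (((1 + n.natAbs : ℕ) : ℝ) ^ 2)⁻¹ :=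
    Summable.of_nat_of_neg (by simpa using h) (by simpa using h)
  convert h2.tsum_ofReal_ne_top using 3 with k
  rw [ENNReal.ofReal_inv_of_pos (by positivity), ENNReal.ofReal_pow (by positivity),
    ENNReal.ofReal_natCast]

/-- The weight dominates each of 1 + k, 1 + l and 1 + |n|, so its sixth power dominates the product
of their squares. This fixes the six powers lost in passing from supremum bounds to ℓ¹ bounds. -/
theorem tsum_wt_inv_ne_top : ∑' κ, ((wt κ : ENNReal) ^ 6)⁻¹ ≠ ⊤ := by
  have h : ∀ κ, ((wt κ : ENNReal) ^ 6)⁻¹ ≤ (((1 + κ.1 : ℕ) : ENNReal) ^ 2)⁻¹ *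
      ((((1 + κ.2.1 : ℕ) : ENNReal) ^ 2)⁻¹ * (((1 + κ.2.2.natAbs : ℕ) : ENNReal) ^ 2)⁻¹) := by
    intro κ
    rw [← ENNReal.mul_inv (by left; norm_cast; positivity) (by left; finiteness),
      ← ENNReal.mul_inv (by left; norm_cast; positivity) (by left; finiteness),
      ENNReal.inv_le_inv, ← mul_pow, ← mul_pow, show 6 = 3 * 2 from rfl, pow_mul]
    gcongr
    norm_cast
    rw [pow_succ, pow_two, ← mul_assoc]
    gcongr <;> unfold wt <;> omega
  refine ne_top_of_le_ne_top ?_ (ENNReal.tsum_le_tsum h)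
  rw [ENNReal.tsum_prod']
  simp only [ENNReal.tsum_mul_left, ENNReal.tsum_mul_right]
  refine ENNReal.mul_ne_top tsum_nat_inv_sq_ne_top ?_
  rw [ENNReal.tsum_prod']
  simp only [ENNReal.tsum_mul_left, ENNReal.tsum_mul_right]
  exact ENNReal.mul_ne_top tsum_nat_inv_sq_ne_top tsum_int_inv_sq_ne_top

theorem mul_pow_le_of_mul_pow_add_le {x C : ENNReal} {a p q : ℕ} (ha : a ≠ 0)
    (h : x * (a : ENNReal) ^ (p + q) ≤ C) :
    x * (a : ENNReal) ^ p ≤ C * ((a : ENNReal) ^ q)⁻¹ := by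
  rw [← ENNReal.div_eq_inv_mul.trans (mul_comm _ _),
    ENNReal.le_div_iff_mul_le (by left; norm_cast; positivity) (by left; finiteness), mul_assoc,
    ← pow_add]
  exact h

theorem JN_le_of_bound {p : ℕ} {x : H →L[ℂ] H} {C : ENNReal}
    (h : ∀ κ, ‖coef κ x‖ₑ * (wt κ : ENNReal) ^ (p + 6) ≤ C) :
    JN p x ≤ C * ∑' κ, ((wt κ : ENNReal) ^ 6)⁻¹ := by
  rw [← ENNReal.tsum_mul_left]
  exact ENNReal.tsum_le_tsum fun κ =>
    mul_pow_le_of_mul_pow_add_le (by have := one_le_wt κ; omega) (h κ)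

theorem tsum_int_le_of_bound {p : ℕ} {φ : ℤ → ENNReal} {C : ENNReal}
    (h : ∀ n, φ n * ((1 + n.natAbs : ℕ) : ENNReal) ^ (p + 2) ≤ C) :
    ∑' n, φ n * ((1 + n.natAbs : ℕ) : ENNReal) ^ p ≤
      C * ∑' n : ℤ, (((1 + n.natAbs : ℕ) : ENNReal) ^ 2)⁻¹ := by
  rw [← ENNReal.tsum_mul_left]
  exact ENNReal.tsum_le_tsum fun n => mul_pow_le_of_mul_pow_add_le (by omega) (h n)

/-- Moments in `|n|` control moments in `1 + |n|`. -/
theorem exists_bound_one_add {ι : Type*} {E : Type*} [NormedAddCommGroup E] {f : ι → E}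
    {n : ι → ℤ} (h : ∀ m : ℕ, ∃ C, ∀ t, |(n t : ℝ)| ^ m * ‖f t‖ ≤ C) (m : ℕ) :
    ∃ C : ℝ, ∀ t, ((1 + (n t).natAbs : ℕ) : ℝ) ^ m * ‖f t‖ ≤ C := by
  obtain ⟨C, hC⟩ := h 0
  obtain ⟨D, hD⟩ := h m
  -- C covers n = 0; for n ≠ 0 one has 1 + |n| ≤ 2|n|, and D applies.
  refine ⟨C + 2 ^ m * D, fun t => ?_⟩
  have h1 := hC t
  have h2 := hD t
  rw [pow_zero, one_mul] at h1
  have hf := norm_nonneg (f t)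
  have hD0 : 0 ≤ D := h2.trans' (by positivity)
  push_cast
  rw [Nat.cast_natAbs, Int.cast_abs]
  by_cases hn : n t = 0
  · rw [hn]
    simp only [Int.cast_zero, abs_zero, add_zero, one_pow, one_mul]
    have : 0 ≤ 2 ^ m * D := by positivity
    linarith
  · have h3 : 1 ≤ |(n t : ℝ)| := by exact_mod_cast Int.one_le_abs hn
    calc (1 + |(n t : ℝ)|) ^ m * ‖f t‖ ≤ (2 * |(n t : ℝ)|) ^ m * ‖f t‖ := by
          gcongr
          linarith
      _ = 2 ^ m * (|(n t : ℝ)| ^ m * ‖f t‖) := by ring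
      _ ≤ 2 ^ m * D := by gcongr
      _ ≤ C + 2 ^ m * D := by linarith

/-! ### Uniform families of symbols and of smoothing operators -/

section Families

variable {ι : Type*}

/-- A family of sequences that is bounded in all weighted `ℓ¹` norms. -/
def UT (φ : ι → ℤ → ℂ) : Prop := ∀ p, ∃ C : ENNReal, C ≠ ⊤ ∧ ∀ t, TN p (φ t) ≤ C

/-- A family of operators in the commutant that is bounded in all weighted `ℓ¹` norms. -/
structure UJ (x : ι → H →L[ℂ] H) : Prop where
  mem : ∀ t, x t ∈ commA
  bdd : ∀ p, ∃ C : ENNReal, C ≠ ⊤ ∧ ∀ t, JN p (x t) ≤ C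

theorem UT.ne_top {φ : ι → ℤ → ℂ} (h : UT φ) (p : ℕ) (t : ι) : TN p (φ t) ≠ ⊤ := by
  obtain ⟨C, hC, h⟩ := h p
  exact ne_top_of_le_ne_top hC (h t)

theorem UJ.ne_top {x : ι → H →L[ℂ] H} (h : UJ x) (p : ℕ) (t : ι) : JN p (x t) ≠ ⊤ := by
  obtain ⟨C, hC, h⟩ := h.bdd p
  exact ne_top_of_le_ne_top hC (h t)

theorem UT.of_bound {φ : ι → ℤ → ℂ}
    (h : ∀ m : ℕ, ∃ C, ∀ t (n : ℤ), |(n : ℝ)| ^ m * ‖φ t n‖ ≤ C) : UT φ := fun p => by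
  obtain ⟨C, hC⟩ := exists_bound_one_add (f := fun q : ι × ℤ => φ q.1 q.2) (n := Prod.snd)
    (fun m => (h m).imp fun C hC q => hC q.1 q.2) (p + 2)
  refine ⟨_, ENNReal.mul_ne_top (ENNReal.ofReal_ne_top (r := C)) tsum_int_inv_sq_ne_top,
    fun t => ?_⟩
  exact tsum_int_le_of_bound fun n => enorm_mul_pow_le (hC (t, n))

theorem UT.const {φ : ℤ → ℂ} (h : ∀ p, TN p φ ≠ ⊤) : UT fun _ : ι => φ :=
  fun p => ⟨_, h p, fun _ => le_rfl⟩

theorem UJ.const {x : H →L[ℂ] H} (hx : x ∈ commA) (h : ∀ p, JN p x ≠ ⊤) : UJ fun _ : ι => x :=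
  ⟨fun _ => hx, fun p => ⟨_, h p, fun _ => le_rfl⟩⟩

theorem UJ.add {x y : ι → H →L[ℂ] H} (hx : UJ x) (hy : UJ y) : UJ fun t => x t + y t := by
  refine ⟨fun t => add_mem (hx.mem t) (hy.mem t), fun p => ?_⟩
  obtain ⟨C, hC, h1⟩ := hx.bdd p
  obtain ⟨D, hD, h2⟩ := hy.bdd p
  exact ⟨C + D, ENNReal.add_ne_top.2 ⟨hC, hD⟩,
    fun t => (JN_add p _ _).trans (add_le_add (h1 t) (h2 t))⟩

theorem UJ.neg {x : ι → H →L[ℂ] H} (hx : UJ x) : UJ fun t => -x t := by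
  refine ⟨fun t => neg_mem (hx.mem t), fun p => ?_⟩
  simpa only [JN_neg] using hx.bdd p

theorem UJ.sub {x y : ι → H →L[ℂ] H} (hx : UJ x) (hy : UJ y) : UJ fun t => x t - y t := by
  simpa only [sub_eq_add_neg] using hx.add hy.neg

theorem UJ.smul {x : ι → H →L[ℂ] H} (hx : UJ x) (c : ℂ) : UJ fun t => c • x t := by
  refine ⟨fun t => commA.smul_mem (hx.mem t) c, fun p => ?_⟩
  obtain ⟨C, hC, h1⟩ := hx.bdd p
  refine ⟨‖c‖ₑ * C, ENNReal.mul_ne_top enorm_ne_top hC, fun t => ?_⟩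
  rw [JN_smul]
  gcongr
  exact h1 t

theorem UJ.mul {x y : ι → H →L[ℂ] H} (hx : UJ x) (hy : UJ y) : UJ fun t => x t * y t := by
  refine ⟨fun t => mul_mem (hx.mem t) (hy.mem t), fun p => ?_⟩
  obtain ⟨C, hC, h1⟩ := hx.bdd p
  obtain ⟨D, hD, h2⟩ := hy.bdd p
  exact ⟨C * D, ENNReal.mul_ne_top hC hD, fun t => (JN_mul_le p (hx.mem t) (hy.mem t)
    (hx.ne_top 0 t) (hy.ne_top 0 t)).trans (mul_le_mul' (h1 t) (h2 t))⟩

theorem UT.toep_mul {φ : ι → ℤ → ℂ} {x : ι → H →L[ℂ] H} (hφ : UT φ) (hx : UJ x) :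
    UJ fun t => toep (φ t) * x t := by
  refine ⟨fun t => mul_mem (toep_mem_commA _) (hx.mem t), fun p => ?_⟩
  obtain ⟨C, hC, h1⟩ := hφ p
  obtain ⟨D, hD, h2⟩ := hx.bdd p
  exact ⟨C * D, ENNReal.mul_ne_top hC hD, fun t => (JN_toep_mul_le p (hφ.ne_top 0 t) (hx.mem t)
    (hx.ne_top 0 t)).trans (mul_le_mul' (h1 t) (h2 t))⟩

theorem UJ.mul_toep {φ : ι → ℤ → ℂ} {x : ι → H →L[ℂ] H} (hx : UJ x) (hφ : UT φ) :
    UJ fun t => x t * toep (φ t) := by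
  refine ⟨fun t => mul_mem (hx.mem t) (toep_mem_commA _), fun p => ?_⟩
  obtain ⟨C, hC, h1⟩ := hφ p
  obtain ⟨D, hD, h2⟩ := hx.bdd p
  exact ⟨C * D, ENNReal.mul_ne_top hC hD, fun t => (JN_mul_toep_le p (hφ.ne_top 0 t) (hx.mem t)
    (hx.ne_top 0 t)).trans (mul_le_mul' (h1 t) (h2 t))⟩

theorem UT.toep_mul_toep_sub {φ ψ : ι → ℤ → ℂ} (hφ : UT φ) (hψ : UT ψ) :
    UJ fun t => toep (φ t) * toep (ψ t) - toep (conv (φ t) (ψ t)) := by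
  refine ⟨fun t => sub_mem (mul_mem (toep_mem_commA _) (toep_mem_commA _)) (toep_mem_commA _),
    fun p => ?_⟩
  obtain ⟨C, hC, h1⟩ := hφ (p + 1)
  obtain ⟨D, hD, h2⟩ := hψ (p + 1)
  exact ⟨C * D, ENNReal.mul_ne_top hC hD, fun t => (JN_toep_mul_toep_le p (hφ.ne_top 0 t)
    (hψ.ne_top 0 t)).trans (mul_le_mul' (h1 t) (h2 t))⟩

end Families

/-! ### The circle action on `β` -/

/-- The diagonal unitary with eigenvalue `exp(i d θ)` on the vectors of degree `d`. -/
def expD (θ : ℝ) : H →L[ℂ] H :=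
  coordOp (fun p => chr (p.a - p.b) θ) id (fun _ => (norm_chr _ _).le) Function.injective_id.injOn

theorem expD_vec (θ : ℝ) (k : ℕ) (d : ℤ) (m : ℕ) :
    expD θ (vec k d m) = chr d θ • vec k d m := by
  have h : ((idx k d m).a : ℤ) - (idx k d m).b = d := by
    simp only [idx]
    omega
  have := coordOp_e (fun p => chr (p.a - p.b) θ) id (fun p => (norm_chr _ _).le)
    Function.injective_id.injOn (idx k d m) (by rw [← norm_ne_zero_iff, norm_chr]; exact one_ne_zero)
  rw [id, h] at this
  rw [vec, map_smul, expD, this, smul_comm]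

theorem norm_expD_le (θ : ℝ) : ‖expD θ‖ ≤ 1 := norm_coordOp_le _ _ _ _

theorem chr_neg_right (n : ℤ) (θ : ℝ) : chr n (-θ) = chr (-n) θ := by
  simp [chr]

theorem chr_neg_mul (n : ℤ) (θ : ℝ) : chr (-n) θ * chr n θ = 1 := by
  rw [← chr_add, neg_add_cancel]
  simp [chr]

theorem expD_neg_mul (θ : ℝ) : expD (-θ) * expD θ = 1 := by
  refine ext_vec fun k d m => ?_
  rw [mul_apply_eq_comp, expD_vec, map_smul, expD_vec, smul_smul, chr_neg_right, mul_comm,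
    chr_neg_mul, one_smul]
  rfl

theorem expD_mul_neg (θ : ℝ) : expD θ * expD (-θ) = 1 := by
  simpa using expD_neg_mul (-θ)

/-- The action of the circle on operators. -/
def ad (θ : ℝ) : (H →L[ℂ] H) →L[ℂ] (H →L[ℂ] H) := (mulL (expD θ)).comp (mulR (expD (-θ)))

theorem ad_apply (θ : ℝ) (x : H →L[ℂ] H) : ad θ x = expD θ * (x * expD (-θ)) := rfl

theorem ad_mul (θ : ℝ) (x y : H →L[ℂ] H) : ad θ (x * y) = ad θ x * ad θ y := by
  simp only [ad_apply, mul_assoc]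
  rw [← mul_assoc (expD (-θ)), expD_neg_mul, one_mul]

theorem ad_one (θ : ℝ) : ad θ 1 = 1 := by
  rw [ad_apply, one_mul, expD_mul_neg]

theorem norm_ad_le (θ : ℝ) (x : H →L[ℂ] H) : ‖ad θ x‖ ≤ ‖x‖ := by
  rw [ad_apply]
  calc ‖expD θ * (x * expD (-θ))‖ ≤ ‖expD θ‖ * (‖x‖ * ‖expD (-θ)‖) :=
        (norm_mul_le _ _).trans (by gcongr; exact norm_mul_le _ _)
    _ ≤ 1 * (‖x‖ * 1) := by
        gcongr
        exacts [norm_expD_le _, norm_expD_le _]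
    _ = ‖x‖ := by ring

theorem ad_vec (θ : ℝ) (x : H →L[ℂ] H) (k : ℕ) (d : ℤ) (m : ℕ) :
    ad θ x (vec k d m) = chr (-d) θ • expD θ (x (vec k d m)) := by
  rw [ad_apply, mul_apply_eq_comp, mul_apply_eq_comp, expD_vec, chr_neg_right, map_smul, map_smul]

theorem ad_cell (θ : ℝ) (κ : ℕ × ℕ × ℤ) : ad θ (cell κ) = chr κ.2.2 θ • cell κ := by
  obtain ⟨k, l, n⟩ := κ
  refine ext_vec fun j d m => ?_
  rw [ad_vec, smul_apply, cell_vec]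
  split_ifs
  · rw [expD_vec, smul_smul, ← chr_add, neg_add_cancel_left]
  · simp

theorem ad_tau (θ : ℝ) (n : ℤ) : ad θ (tau n) = tau n := by
  refine ext_vec fun j d m => ?_
  rw [ad_vec, tau_vec]
  split_ifs
  · rw [expD_vec, smul_smul, chr_neg_mul, one_smul]
  · simp

theorem ad_toep (θ : ℝ) {φ : ℤ → ℂ} (h : TN 0 φ ≠ ⊤) : ad θ (toep φ) = toep φ := by
  have := (hasSum_toep h).mapL (ad θ)
  simp only [map_smul, ad_tau] at this
  exact this.unique (hasSum_toep h)

/-- Each cell is an eigenvector of the circle action, with frequency its exponent of β. Rapid decay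
of the coefficients thus becomes smoothness of the orbit. -/
theorem ad_eq_expSum (θ : ℝ) {x : H →L[ℂ] H} (hx : x ∈ commA) (h : JN 0 x ≠ ⊤) :
    ad θ x = expSum (fun κ => coef κ x) (fun κ => κ.2.2) cell θ := by
  have := (hasSum_cell hx h).mapL (ad θ)
  simp only [map_smul, ad_cell, smul_smul] at this
  exact this.tsum_eq.symm

theorem moments_coef {x : H →L[ℂ] H} (h : ∀ p, JN p x ≠ ⊤) :
    Moments (fun κ => coef κ x) (fun κ => κ.2.2) := fun p => by
  have : Summable fun κ => ‖((wt κ : ℂ) ^ p) * coef κ x‖ := by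
    refine tsum_enorm_ne_top_iff_summable_norm.1 ?_
    refine ne_of_eq_of_ne (tsum_congr fun κ => ?_) (h p)
    rw [enorm_mul, enorm_pow, mul_comm, ← ofReal_norm (wt κ : ℂ), Complex.norm_natCast,
      ENNReal.ofReal_natCast]
  refine this.of_nonneg_of_le (fun κ => by positivity) fun κ => ?_
  rw [norm_mul, norm_pow, Complex.norm_natCast]
  gcongr
  rw [← Int.cast_abs, ← Nat.cast_natAbs]
  norm_cast
  unfold wt
  dsimp only
  omega

theorem inner_ad (θ : ℝ) (x : H →L[ℂ] H) (k : ℕ) (d : ℤ) (m k' : ℕ) (d' : ℤ) (m' : ℕ) :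
    ⟪vec k d m, ad θ x (vec k' d' m')⟫_ℂ =
      ⟪vec k d m, x (vec k' d' m')⟫_ℂ * chr (d - d') θ := by
  have hs : star (expD θ) (vec k d m) = chr (-d) θ • vec k d m := by
    have h : ((idx k d m).a : ℤ) - (idx k d m).b = d := by
      simp only [idx]
      omega
    rw [vec, map_smul, expD, star_coordOp_e, h, id, smul_comm]
    congr 2
    rw [chr, chr, ← Complex.exp_conj]
    simp
  rw [ad_vec, inner_smul_right, ← ContinuousLinearMap.adjoint_inner_left,
    ← ContinuousLinearMap.star_eq_adjoint, hs, inner_smul_left, sub_eq_add_neg, chr_add]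
  have : (starRingEnd ℂ) (chr (-d) θ) = chr d θ := by
    rw [chr, chr, ← Complex.exp_conj]
    simp
  rw [this]
  ring

/-- The inverses of a uniformly smooth family have rapidly decaying matrix coefficients. -/
theorem inverse_bound {ι : Type*} {φ : ℤ → ℂ} {x : H →L[ℂ] H} (hφ : ∀ p, TN p φ ≠ ⊤)
    (hx : x ∈ commA) (hxJ : ∀ p, JN p x ≠ ⊤) {z : ι → ℂ} {y : ι → H →L[ℂ] H} {R C : ℝ}
    (hz : ∀ t, ‖z t‖ ≤ R) (hy : ∀ t, ‖y t‖ ≤ C) (h1 : ∀ t, (z t • 1 - (toep φ + x)) * y t = 1)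
    (h2 : ∀ t, y t * (z t • 1 - (toep φ + x)) = 1) (m : ℕ) :
    ∃ C : ENNReal, C ≠ ⊤ ∧ ∀ t k d k' d',
      ‖⟪vec k d 0, y t (vec k' d' 0)⟫_ℂ‖ₑ * ((1 + (d - d').natAbs : ℕ) : ENNReal) ^ m ≤ C := by
  -- Scalars and the Toeplitz part are fixed by the action, so the parameter t enters only through a
  -- bounded constant; the rest is a single smooth orbit.
  have hG : ∀ m, UBd m fun t θ => ad θ (z t • 1 - (toep φ + x)) := fun m => by
    have hc : UBd m fun (t : ι) (_ : ℝ) => z t • (1 : H →L[ℂ] H) - toep φ := by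
      have hb : ∀ t, ‖z t • (1 : H →L[ℂ] H) - toep φ‖ ≤ R * 1 + ‖toep φ‖ := fun t => by
        refine norm_sub_le_of_le ?_ le_rfl
        rw [norm_smul]
        gcongr
        exacts [(norm_nonneg _).trans (hz t), hz t, ContinuousLinearMap.norm_id_le]
      exact uBd_const hb m
    have hs := (moments_coef hxJ).uBd (ι := ι) norm_cell_le m
    have := hc.add hs.neg
    convert this using 4 with t θ
    rw [map_sub, map_add, map_smul, ad_one, ad_toep θ (hφ 0), ad_eq_expSum θ hx (hxJ 0),
      ← sub_sub, sub_eq_add_neg]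
  -- The action is multiplicative, unital and contractive, so `ad θ (y t)` is the inverse of the
  -- previous family and is still bounded by C.
  have hK : ∀ m, UBd m fun t θ => ad θ (y t) := fun m =>
    (hG m).inverse (fun t θ => by rw [← ad_mul, h1, ad_one])
      (fun t θ => by rw [← ad_mul, h2, ad_one]) fun t θ => (norm_ad_le θ _).trans (hy t)
  obtain ⟨D, hD⟩ := exists_bound_one_add
    (f := fun q : ι × ℕ × ℤ × ℕ × ℤ =>
      ⟪vec q.2.1 q.2.2.1 0, y q.1 (vec q.2.2.2.1 q.2.2.2.2 0)⟫_ℂ)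
    (n := fun q => q.2.2.1 - q.2.2.2.2) (fun m => by
      refine UBd.bound_of_chr ?_
      have := (hK m).map (ι' := ι × ℕ × ℤ × ℕ × ℤ) Prod.fst
        (fun q => ((innerSL ℂ (vec q.2.1 q.2.2.1 0)).comp
          (ContinuousLinearMap.apply ℂ H (vec q.2.2.2.1 q.2.2.2.2 0))).restrictScalars ℝ) (D := 1)
        fun q => by
          refine ContinuousLinearMap.opNorm_le_bound _ zero_le_one fun x => ?_
          rw [one_mul]
          exact norm_inner_vec_le x _ _ _ _ _ _
      convert this using 3 with q θ
      exact (inner_ad θ _ _ _ _ _ _ _).symm) m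
  exact ⟨ENNReal.ofReal D, ENNReal.ofReal_ne_top,
    fun t k d k' d' => enorm_mul_pow_le (hD (t, k, d, k', d'))⟩

theorem star_cell_vec (k l : ℕ) (n : ℤ) (j : ℕ) (d : ℤ) (m : ℕ) :
    star (cell (k, l, n)) (vec j d m) = if j = k then vec l (d - n) m else 0 := by
  refine sub_eq_zero.1 (vec_eq_zero_of_inner fun k' d' m' => ?_)
  rw [inner_sub_right, ContinuousLinearMap.star_eq_adjoint,
    ContinuousLinearMap.adjoint_inner_right, cell_vec]
  by_cases h1 : k' = l <;> by_cases h2 : j = k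
  · rw [if_pos h1, if_pos h2, inner_vec_vec, inner_vec_vec, sub_eq_zero]
    refine if_congr ?_ rfl rfl
    omega
  · rw [if_pos h1, if_neg h2, inner_vec_vec, if_neg (by omega)]
    simp
  · rw [if_neg h1, if_pos h2, inner_vec_vec, if_neg (by omega)]
    simp
  · simp [h1, h2]

theorem coef_cell_mul_mul_cell (y : H →L[ℂ] H) (k j : ℕ) (n : ℤ) (j' l : ℕ) (n' : ℤ)
    (κ : ℕ × ℕ × ℤ) : coef κ (cell (k, j, n) * y * cell (j', l, n')) =
      if κ.1 = k ∧ κ.2.1 = l then ⟪vec j (κ.2.2 - n) 0, y (vec j' n' 0)⟫_ℂ else 0 := by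
  rw [coef_apply, mul_apply_eq_comp, mul_apply_eq_comp, ← ContinuousLinearMap.adjoint_inner_left,
    ← ContinuousLinearMap.star_eq_adjoint, star_cell_vec, cell_vec, zero_add]
  by_cases h1 : κ.1 = k <;> by_cases h2 : κ.2.1 = l <;> simp [h1, h2]

/-- Between two cells only a single row and a single column survive, so just the sum over the
exponent n remains. Decay of y in d - d' controls it, and the two extra powers make it converge. -/
theorem JN_cell_mul_mul_cell_le {p : ℕ} {y : H →L[ℂ] H} {C : ENNReal}
    (hC : ∀ k d k' d', ‖⟪vec k d 0, y (vec k' d' 0)⟫_ℂ‖ₑ *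
      ((1 + (d - d').natAbs : ℕ) : ENNReal) ^ (p + 2) ≤ C) (κ κ' : ℕ × ℕ × ℤ) :
    JN p (cell κ * y * cell κ') ≤ C * (∑' n : ℤ, (((1 + n.natAbs : ℕ) : ENNReal) ^ 2)⁻¹) *
      (wt κ : ENNReal) ^ p * (wt κ' : ENNReal) ^ p := by
  obtain ⟨k, j, n⟩ := κ
  obtain ⟨j', l, n'⟩ := κ'
  -- With the exponent shifted by n + n', the index i is exactly the difference d - d' for the
  -- coefficient of y that occurs.
  have hi : Function.Injective fun i : ℤ => (k, l, i + (n + n')) := fun a b h => by simpa using h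
  have hsupp : ∀ κ ∉ range fun i : ℤ => (k, l, i + (n + n')),
      ‖coef κ (cell (k, j, n) * y * cell (j', l, n'))‖ₑ * (wt κ : ENNReal) ^ p = 0 := by
    rintro ⟨a, b, i⟩ h
    rw [coef_cell_mul_mul_cell, if_neg]
    · simp
    · rintro ⟨rfl, rfl⟩
      exact h ⟨i - (n + n'), by simp⟩
  rw [JN, ← hi.tsum_eq (Function.support_subset_iff'.2 hsupp)]
  calc ∑' i : ℤ, ‖coef (k, l, i + (n + n')) (cell (k, j, n) * y * cell (j', l, n'))‖ₑ *
        (wt (k, l, i + (n + n')) : ENNReal) ^ p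
      ≤ ∑' i : ℤ, (‖⟪vec j (i + n') 0, y (vec j' n' 0)⟫_ℂ‖ₑ *
          ((1 + i.natAbs : ℕ) : ENNReal) ^ p) *
          ((wt (k, j, n) : ENNReal) ^ p * (wt (j', l, n') : ENNReal) ^ p) := by
        refine ENNReal.tsum_le_tsum fun i => ?_
        rw [coef_cell_mul_mul_cell, if_pos ⟨rfl, rfl⟩, mul_assoc,
          show i + (n + n') - n = i + n' by ring, ← mul_pow, ← mul_pow]
        gcongr
        norm_cast
        simp only [wt, add_assoc 1]
        refine le_trans ?_ (Nat.mul_le_mul_left _ (le_one_add_mul_one_add le_rfl))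
        rw [add_assoc 1]
        exact le_one_add_mul_one_add (by omega)
    _ ≤ C * (∑' n : ℤ, (((1 + n.natAbs : ℕ) : ENNReal) ^ 2)⁻¹) *
          ((wt (k, j, n) : ENNReal) ^ p * (wt (j', l, n') : ENNReal) ^ p) := by
        rw [ENNReal.tsum_mul_right]
        gcongr
        refine tsum_int_le_of_bound fun i => ?_
        simpa using hC j (i + n') j' n'
    _ = _ := by ring

/-- The middle factor need not be smoothing: decay in k and l comes from the outer factors, and y
must only not destroy decay in the d direction. -/
theorem UJ.mul_mul {ι : Type*} {x x' y : ι → H →L[ℂ] H} (hx : UJ x) (hx' : UJ x')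
    (hym : ∀ t, y t ∈ commA) (hy : ∀ m : ℕ, ∃ C : ENNReal, C ≠ ⊤ ∧ ∀ t k d k' d',
      ‖⟪vec k d 0, y t (vec k' d' 0)⟫_ℂ‖ₑ * ((1 + (d - d').natAbs : ℕ) : ENNReal) ^ m ≤ C) :
    UJ fun t => x t * y t * x' t := by
  refine ⟨fun t => mul_mem (mul_mem (hx.mem t) (hym t)) (hx'.mem t), fun p => ?_⟩
  obtain ⟨A, hA, h1⟩ := hx.bdd p
  obtain ⟨B, hB, h2⟩ := hx'.bdd p
  obtain ⟨C, hC, h3⟩ := hy (p + 2)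
  set S : ENNReal := ∑' n : ℤ, (((1 + n.natAbs : ℕ) : ENNReal) ^ 2)⁻¹ with hS
  have hSt : S ≠ ⊤ := tsum_int_inv_sq_ne_top
  refine ⟨C * S * A * B, by finiteness, fun t => ?_⟩
  have hcell : ∀ κ', JN p (x t * y t * cell κ') ≤ C * S * A * (wt κ' : ENNReal) ^ p := by
    intro κ'
    have := JN_map_le (mulR (y t * cell κ')) (p := p) (q := p)
      (A := C * S * (wt κ' : ENNReal) ^ p) (fun κ => ?_) (hx.mem t) (hx.ne_top 0 t)
    · rw [mul_assoc]
      refine this.trans ?_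
      rw [mul_right_comm]
      gcongr
      exact h1 t
    · rw [mul_right_comm]
      change JN p (cell κ * (y t * cell κ')) ≤ _
      rw [← mul_assoc]
      exact JN_cell_mul_mul_cell_le (h3 t) κ κ'
  refine (JN_map_le (mulL (x t * y t)) hcell (hx'.mem t) (hx'.ne_top 0 t)).trans ?_
  gcongr
  exact h2 t

/-! ### Approximate eigenvectors and the symbol -/

theorem α_mul_star_α : α * star α = 1 := by
  refine ext_vec fun k d m => ?_
  rw [mul_apply_eq_comp, star_α_vec, α_vec_succ]
  rfl

theorem cell_zero : cell (0, 0, 0) = 1 - star α * α := by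
  refine ext_vec fun k d m => ?_
  rw [cell_vec, sub_apply, mul_apply_eq_comp]
  rcases k with _ | k
  · simp [α_vec_zero]
  · simp [α_vec_succ, star_α_vec]

/-- Eigenvectors of `α`. -/
theorem exists_eigenvector {ζ : ℂ} (hζ : ‖ζ‖ < 1) : ∃ ξ : H, ‖ξ‖ = 1 ∧ α ξ = ζ • ξ := by
  have hn : ‖ζ • star α‖ < 1 := by
    rw [norm_smul]
    exact (mul_le_of_le_one_right (norm_nonneg _)
      ((norm_star α).trans_le norm_α_le)).trans_lt hζ
  set u := Units.oneSub (ζ • star α) hn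
  -- The eigenvector is (1 - ζ α*)⁻¹ applied to the vacuum `vec 0 0 0`; it works because α α* = 1
  -- and α kills the vacuum.
  have hu : (u : H →L[ℂ] H) = 1 - ζ • star α := rfl
  set η : H := (↑u⁻¹ : H →L[ℂ] H) (vec 0 0 0) with hη
  have h1 : η - ζ • star α η = vec 0 0 0 := by
    have : (u : H →L[ℂ] H) η = vec 0 0 0 := by
      rw [hη, ← mul_apply_eq_comp, Units.mul_inv]
      rfl
    rw [← this, hu]
    rfl
  have h2 : α η = ζ • η := by
    have h3 : α (star α η) = η := congr($α_mul_star_α η)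
    have := congr(α $h1)
    rw [map_sub, map_smul, h3, α_vec_zero, sub_eq_zero] at this
    exact this
  have h0 : η ≠ 0 := by
    intro h
    rw [h, map_zero, smul_zero, sub_zero] at h1
    have := norm_vec 0 0 0
    rw [← h1, norm_zero] at this
    exact zero_ne_one this
  refine ⟨(‖η‖⁻¹ : ℂ) • η, norm_smul_inv_norm h0, ?_⟩
  rw [map_smul, h2, smul_comm]

/-- Here (1 - α* α) ξ = ξ - ζ α* ξ, with α* isometric and ⟨ξ, ζ α* ξ⟩ = |ζ|². As |ζ| → 1 the vectors
therefore escape the projection `cell (0, 0, 0)`. -/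
theorem norm_cell_zero_eigenvector {ζ : ℂ} {ξ : H} (hξ : ‖ξ‖ = 1) (h : α ξ = ζ • ξ) :
    ‖cell (0, 0, 0) ξ‖ ^ 2 = 1 - ‖ζ‖ ^ 2 := by
  have h1 : cell (0, 0, 0) ξ = ξ - ζ • star α ξ := by
    rw [cell_zero, sub_apply, mul_apply_eq_comp, h, map_smul]
    rfl
  have h2 : ‖star α ξ‖ = 1 := by
    have h3 : ‖star α ξ‖ ≤ 1 := by
      have := (star α).le_opNorm ξ
      rw [hξ, mul_one] at this
      exact this.trans ((norm_star α).trans_le norm_α_le)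
    have h4 : 1 ≤ ‖star α ξ‖ := by
      have h5 : α (star α ξ) = ξ := congr($α_mul_star_α ξ)
      have := α.le_opNorm (star α ξ)
      rw [h5, hξ] at this
      exact this.trans (mul_le_of_le_one_left (norm_nonneg _) norm_α_le)
    exact le_antisymm h3 h4
  have h3 : ⟪ξ, ζ • star α ξ⟫_ℂ = ((‖ζ‖ ^ 2 : ℝ) : ℂ) := by
    rw [inner_smul_right, ContinuousLinearMap.star_eq_adjoint,
      ContinuousLinearMap.adjoint_inner_right, h, inner_smul_left, inner_self_eq_norm_sq_to_K, hξ,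
      Complex.ofReal_pow, ← Complex.mul_conj']
    simp
  rw [h1, @norm_sub_sq ℂ, h3, norm_smul, h2, hξ]
  simp only [RCLike.re_to_complex, Complex.ofReal_re]
  ring

theorem tendsto_pow_sub {A : H →L[ℂ] H} {c : ℂ} {ξ : ℕ → H}
    (h : Filter.Tendsto (fun j => A (ξ j) - c • ξ j) Filter.atTop (𝓝 0)) (m : ℕ) :
    Filter.Tendsto (fun j => (A ^ m) (ξ j) - c ^ m • ξ j) Filter.atTop (𝓝 0) := by
  induction m with
  | zero => simp
  | succ m ih =>
    have h1 := ((A.continuous.tendsto 0).comp ih).add (h.const_smul (c ^ m))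
    rw [map_zero, smul_zero, add_zero] at h1
    refine h1.congr fun j => ?_
    simp only [Function.comp_apply, map_sub, map_smul, pow_succ' A, mul_apply_eq_comp, smul_sub,
      smul_smul, pow_succ c]
    abel

theorem chr_pow (n : ℤ) (θ : ℝ) (m : ℕ) : chr n θ ^ m = chr (m * n) θ := by
  rw [chr, chr, ← Complex.exp_nat_mul]
  congr 1
  push_cast
  ring

/-- Unit vectors that are asymptotically eigenvectors of all `tau n`, and are annihilated
asymptotically by the smoothing operators. -/
theorem exists_approx_eigenvectors (θ : ℝ) : ∃ ξ : ℕ → H, (∀ j, ‖ξ j‖ = 1) ∧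
    (∀ κ, Filter.Tendsto (fun j => cell κ (ξ j)) Filter.atTop (𝓝 0)) ∧
    ∀ n, Filter.Tendsto (fun j => tau n (ξ j) - chr n θ • ξ j) Filter.atTop (𝓝 0) := by
  -- The vectors are eigenvectors of α with eigenvalue r_j exp(iθ), where r_j increases to 1.
  let r : ℕ → ℝ := fun j => 1 - 1 / ((j : ℝ) + 1)
  have hr : Filter.Tendsto r Filter.atTop (𝓝 1) := by
    simpa [r] using (tendsto_one_div_add_atTop_nhds_zero_nat (𝕜 := ℝ)).const_sub 1
  have hr0 : ∀ j, 0 ≤ r j := fun j => by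
    simp only [r, sub_nonneg]
    exact div_le_one_of_le₀ (by have := j.cast_nonneg (α := ℝ); linarith) (by positivity)
  have hr1 : ∀ j, r j < 1 := fun j => by
    have : 0 < 1 / ((j : ℝ) + 1) := by positivity
    simp only [r]
    linarith
  have hζ : ∀ j, ‖(r j : ℂ) * chr 1 θ‖ = r j := fun j => by
    rw [norm_mul, norm_chr, mul_one, Complex.norm_real, Real.norm_of_nonneg (hr0 j)]
  choose ξ hξ hα using fun j => exists_eigenvector ((hζ j).trans_lt (hr1 j))
  have he : Filter.Tendsto (fun j => cell (0, 0, 0) (ξ j)) Filter.atTop (𝓝 0) := by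
    rw [tendsto_zero_iff_norm_tendsto_zero]
    have h1 : Filter.Tendsto (fun j => √(1 - r j ^ 2)) Filter.atTop (𝓝 0) := by
      have := ((hr.pow 2).const_sub 1).sqrt
      simpa using this
    refine h1.congr fun j => ?_
    rw [← hζ j, ← norm_cell_zero_eigenvector (hξ j) (hα j), Real.sqrt_sq (norm_nonneg _)]
  have hrξ : ∀ v : ℕ → H, (∀ j, ‖v j‖ ≤ 1) → ∀ c : ℂ,
      Filter.Tendsto (fun j => (((r j - 1 : ℝ) : ℂ) * c) • v j) Filter.atTop (𝓝 0) := by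
    intro v hv c
    rw [tendsto_zero_iff_norm_tendsto_zero]
    have h1 : Filter.Tendsto (fun j => |r j - 1| * ‖c‖) Filter.atTop (𝓝 0) := by
      have := (hr.sub_const 1).abs.mul_const ‖c‖
      simpa using this
    refine squeeze_zero (fun _ => norm_nonneg _) (fun j => ?_) h1
    rw [norm_smul, norm_mul, Complex.norm_real, Real.norm_eq_abs]
    exact mul_le_of_le_one_right (by positivity) (hv j)
  have h1 : Filter.Tendsto (fun j => α (ξ j) - chr 1 θ • ξ j) Filter.atTop (𝓝 0) := by
    refine (hrξ ξ (fun j => (hξ j).le) (chr 1 θ)).congr fun j => ?_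
    rw [hα, ← sub_smul]
    congr 1
    push_cast
    ring
  -- From ξ = (1 - α* α) ξ + r exp(iθ) α* ξ one gets α* ξ - exp(-iθ) ξ = (1 - r) α* ξ - exp(-iθ) (1
  -- - α* α) ξ.
  have h2 : Filter.Tendsto (fun j => star α (ξ j) - chr (-1) θ • ξ j) Filter.atTop (𝓝 0) := by
    have h3 := (hrξ (fun j => star α (ξ j)) (fun j => by
      have := (star α).le_opNorm (ξ j)
      rw [hξ, mul_one] at this
      exact this.trans ((norm_star α).trans_le norm_α_le)) 1).add (he.const_smul (chr (-1) θ))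
    have h4 := h3.neg
    rw [smul_zero, add_zero, neg_zero] at h4
    refine h4.congr fun j => ?_
    rw [cell_zero, sub_apply, mul_apply_eq_comp, hα, map_smul, smul_sub, smul_smul,
      mul_left_comm, chr_neg_mul]
    simp only [one_apply_eq_self]
    push_cast
    module
  refine ⟨ξ, hξ, fun κ => ?_, fun n => ?_⟩
  · obtain ⟨k, l, n⟩ := κ
    -- Every cell factors through the projection that kills the vectors in the limit, after a power
    -- of α that acts asymptotically as a scalar.
    have hc : cell (k, l, n) = cell (k, 0, n) * cell (0, 0, 0) * α ^ l := by
      have : tau l = α ^ l := by simp [tau]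
      rw [cell_mul_cell, if_pos rfl, ← this, cell_mul_tau]
      simp
    have h3 := (((cell (k, 0, n) * cell (0, 0, 0)).continuous.tendsto 0).comp
      (tendsto_pow_sub h1 l)).add
      ((((cell (k, 0, n)).continuous.tendsto 0).comp he).const_smul (chr 1 θ ^ l))
    rw [map_zero, map_zero, smul_zero, add_zero] at h3
    refine h3.congr fun j => ?_
    rw [hc]
    simp only [Function.comp_apply, map_sub, map_smul, mul_apply_eq_comp]
    abel
  · unfold tau
    split_ifs with hn
    · convert tendsto_pow_sub h1 n.toNat using 5 with j
      rw [chr_pow]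
      congr 1
      omega
    · convert tendsto_pow_sub h2 (-n).toNat using 5 with j
      rw [chr_pow]
      congr 1
      omega

/-- A lower bound for the symbol of an invertible operator. -/
theorem one_le_mul_symbol {φ : ℤ → ℂ} {x y : H →L[ℂ] H} (hφ : TN 0 φ ≠ ⊤) (hx : x ∈ commA)
    (hxJ : JN 0 x ≠ ⊤) {z : ℂ} {C : ℝ} (hy : ‖y‖ ≤ C) (h : y * (z • 1 - (toep φ + x)) = 1)
    (θ : ℝ) : 1 ≤ C * ‖z - expSum φ id (fun _ => (1 : ℂ)) θ‖ := by
  obtain ⟨ξ, hξ, hcell, htau⟩ := exists_approx_eigenvectors θ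
  set σ := expSum φ id (fun _ => (1 : ℂ)) θ with hσ
  have h1 : Filter.Tendsto (fun j => toep φ (ξ j) - σ • ξ j) Filter.atTop (𝓝 0) := by
    have hs : ∀ j, toep φ (ξ j) - σ • ξ j = ∑' n, φ n • (tau n (ξ j) - chr n θ • ξ j) := by
      intro j
      have e1 := (hasSum_toep hφ).mapL (ContinuousLinearMap.apply ℂ H (ξ j))
      have e2 := (hasSum_expSum (n := id) (X := fun _ => (1 : ℂ)) (summable_norm_of_TN hφ)
        (by simp) θ).smul_const (ξ j)
      refine ((e1.sub e2).tsum_eq.symm.trans (tsum_congr fun n => ?_))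
      simp [smul_sub, smul_smul]
    simp only [hs]
    rw [← tsum_zero (α := H) (β := ℤ)]
    refine tendsto_tsum_of_dominated_convergence (bound := fun n => ‖φ n‖ * 2)
      ((summable_norm_of_TN hφ).mul_right 2) (fun n => ?_)
      (Filter.Eventually.of_forall fun j n => ?_)
    · simpa using (htau n).const_smul (φ n)
    · rw [norm_smul]
      gcongr
      refine (norm_sub_le _ _).trans ?_
      rw [norm_smul, norm_chr, hξ, one_mul]
      have := (tau n).le_opNorm (ξ j)
      rw [hξ, mul_one] at this
      linarith [norm_tau_le n]
  have h2 : Filter.Tendsto (fun j => x (ξ j)) Filter.atTop (𝓝 0) := by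
    have hs : ∀ j, x (ξ j) = ∑' κ, coef κ x • cell κ (ξ j) := fun j =>
      ((hasSum_cell hx hxJ).mapL (ContinuousLinearMap.apply ℂ H (ξ j))).tsum_eq.symm
    simp only [hs]
    rw [← tsum_zero (α := H) (β := ℕ × ℕ × ℤ)]
    refine tendsto_tsum_of_dominated_convergence (bound := fun κ => ‖coef κ x‖)
      (tsum_enorm_ne_top_iff_summable_norm.1 (by simpa [JN] using hxJ)) (fun κ => ?_)
      (Filter.Eventually.of_forall fun j κ => ?_)
    · simpa using (hcell κ).const_smul (coef κ x)
    · rw [norm_smul]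
      refine mul_le_of_le_one_right (norm_nonneg _) ?_
      have := (cell κ).le_opNorm (ξ j)
      rw [hξ, mul_one] at this
      exact this.trans (norm_cell_le κ)
  have h3 : Filter.Tendsto (fun j => C * (‖z - σ‖ + ‖toep φ (ξ j) - σ • ξ j‖ + ‖x (ξ j)‖))
      Filter.atTop (𝓝 (C * ‖z - σ‖)) := by
    simpa using ((h1.norm.const_add ‖z - σ‖).add h2.norm).const_mul C
  refine ge_of_tendsto h3 (Filter.Eventually.of_forall fun j => ?_)
  have e1 : y ((z • 1 - (toep φ + x)) (ξ j)) = ξ j := congr($h (ξ j))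
  calc 1 = ‖y ((z • 1 - (toep φ + x)) (ξ j))‖ := by rw [e1, hξ]
    _ ≤ C * ‖(z • 1 - (toep φ + x)) (ξ j)‖ := y.le_of_opNorm_le hy _
    _ = C * ‖(z - σ) • ξ j - (toep φ (ξ j) - σ • ξ j) - x (ξ j)‖ := by
      congr 2
      simp only [sub_apply, smul_apply, add_apply, one_apply_eq_self]
      module
    _ ≤ _ := by
      have hC : 0 ≤ C := (norm_nonneg y).trans hy
      gcongr
      refine (norm_sub_le _ _).trans ?_
      gcongr
      refine (norm_sub_le _ _).trans ?_
      rw [norm_smul, hξ, mul_one]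

/-! ### Inverses of uniform families -/

theorem conv_comm (φ ψ : ℤ → ℂ) : conv φ ψ = conv ψ φ := by
  ext n
  rw [conv, conv, ← (Equiv.subLeft n).tsum_eq]
  refine tsum_congr fun i => ?_
  simp [mul_comm]

theorem toep_single : toep (Pi.single 0 1) = 1 := by
  rw [toep, tsum_eq_single 0]
  · simp [tau]
  · intro n hn
    simp [hn]

theorem toep_add {φ ψ : ℤ → ℂ} (hφ : TN 0 φ ≠ ⊤) (hψ : TN 0 ψ ≠ ⊤) :
    toep (φ + ψ) = toep φ + toep ψ := by
  have := (hasSum_toep hφ).add (hasSum_toep hψ)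
  simp only [← add_smul] at this
  exact this.tsum_eq

theorem toep_smul (c : ℂ) {φ : ℤ → ℂ} (hφ : TN 0 φ ≠ ⊤) : toep (c • φ) = c • toep φ := by
  have := (hasSum_toep hφ).const_smul c
  simp only [smul_smul] at this
  exact this.tsum_eq

theorem TN_add (p : ℕ) (φ ψ : ℤ → ℂ) : TN p (φ + ψ) ≤ TN p φ + TN p ψ := by
  rw [TN, TN, TN, ← ENNReal.tsum_add]
  refine ENNReal.tsum_le_tsum fun n => ?_
  rw [← add_mul]
  gcongr
  exact enorm_add_le _ _

theorem TN_smul (p : ℕ) (c : ℂ) (φ : ℤ → ℂ) : TN p (c • φ) = ‖c‖ₑ * TN p φ := by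
  rw [TN, TN, ← ENNReal.tsum_mul_left]
  refine tsum_congr fun n => ?_
  rw [Pi.smul_apply, smul_eq_mul, enorm_mul, mul_assoc]

theorem TN_single (p : ℕ) : TN p (Pi.single 0 1) = 1 := by
  rw [TN, tsum_eq_single 0]
  · simp
  · intro n hn
    simp [hn]

theorem moments_of_TN {φ : ℤ → ℂ} (h : ∀ p, TN p φ ≠ ⊤) : Moments φ id := fun p => by
  have : Summable fun n : ℤ => ‖(((1 + n.natAbs : ℕ) : ℂ) ^ p) * φ n‖ := by
    refine tsum_enorm_ne_top_iff_summable_norm.1 ?_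
    refine ne_of_eq_of_ne (tsum_congr fun n => ?_) (h p)
    rw [enorm_mul, enorm_pow, mul_comm, ← ofReal_norm ((1 + n.natAbs : ℕ) : ℂ),
      Complex.norm_natCast, ENNReal.ofReal_natCast]
  refine this.of_nonneg_of_le (fun n => by positivity) fun n => ?_
  rw [norm_mul, norm_pow, Complex.norm_natCast, id]
  gcongr
  rw [← Int.cast_abs, ← Nat.cast_natAbs]
  norm_cast
  omega

/-- The inverse of `z - (toep φ + x)` is again a Toeplitz operator plus a smoothing operator,
uniformly for bounded families of `z` with bounded inverses. -/
theorem exists_symbol_inverse {ι : Type*} {φ : ℤ → ℂ} {x : H →L[ℂ] H} (hφ : ∀ p, TN p φ ≠ ⊤)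
    (hx : x ∈ commA) (hxJ : ∀ p, JN p x ≠ ⊤) {z : ι → ℂ} {y : ι → H →L[ℂ] H} {R C : ℝ}
    (hz : ∀ t, ‖z t‖ ≤ R) (hy : ∀ t, ‖y t‖ ≤ C) (hym : ∀ t, y t ∈ commA)
    (h1 : ∀ t, (z t • 1 - (toep φ + x)) * y t = 1)
    (h2 : ∀ t, y t * (z t • 1 - (toep φ + x)) = 1) :
    ∃ ψ : ι → ℤ → ℂ, UT ψ ∧ UJ fun t => y t - toep (ψ t) := by
  set σ : ℝ → ℂ := expSum φ id fun _ => (1 : ℂ) with hσ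
  have hσ0 := moments_of_TN hφ
  have hlow : ∀ t θ, 1 ≤ C * ‖z t - σ θ‖ := fun t θ =>
    one_le_mul_symbol (hφ 0) hx (hxJ 0) (hy t) (h2 t) θ
  have hne : ∀ t θ, z t - σ θ ≠ 0 := fun t θ h => by
    have := hlow t θ
    rw [h, norm_zero, mul_zero] at this
    linarith
  have hs : ∀ m, UBd m fun t θ => z t - σ θ := fun m => by
    simpa only [sub_eq_add_neg] using
      (uBd_const hz m).add ((hσ0.uBd (ι := ι) (X := fun _ => (1 : ℂ)) (by simp) m).neg)
  have hinvb : ∀ t θ, ‖(z t - σ θ)⁻¹‖ ≤ C := fun t θ => by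
    rw [norm_inv, inv_le_iff_one_le_mul₀ (norm_pos_iff.2 (hne t θ))]
    exact hlow t θ
  have hinv : ∀ m, UBd m fun t θ => (z t - σ θ)⁻¹ := fun m =>
    (hs m).inverse (fun t θ => mul_inv_cancel₀ (hne t θ)) (fun t θ => inv_mul_cancel₀ (hne t θ))
      hinvb
  have hσp : Function.Periodic σ (2 * Real.pi) := fun θ => by
    simp only [hσ, expSum]
    refine tsum_congr fun n => ?_
    rw [periodic_chr]
  -- The symbol of the parametrix.
  let ψ : ι → ℤ → ℂ := fun t => fourierCoeffOn Real.two_pi_pos fun θ => (z t - σ θ)⁻¹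
  have hψ : UT ψ := UT.of_bound fun m => (hinv m).fourier_bound fun t θ => by simp only [hσp θ]
  let φ' : ι → ℤ → ℂ := fun t => z t • Pi.single 0 1 + (-1 : ℂ) • φ
  have hφ' : UT φ' := fun p => by
    refine ⟨ENNReal.ofReal R + TN p φ, ENNReal.add_ne_top.2 ⟨ENNReal.ofReal_ne_top, hφ p⟩,
      fun t => (TN_add p _ _).trans ?_⟩
    rw [TN_smul, TN_smul, TN_single, mul_one, enorm_neg, enorm_one, one_mul]
    gcongr
    rw [← ofReal_norm]
    exact ENNReal.ofReal_le_ofReal (hz t)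
  have hsingle : TN 0 (Pi.single 0 1 : ℤ → ℂ) ≠ ⊤ := by rw [TN_single]; exact ENNReal.one_ne_top
  have htoep : ∀ t, toep (φ' t) = z t • 1 - toep φ := fun t => by
    rw [toep_add, toep_smul _ hsingle, toep_smul _ (hφ 0), toep_single, neg_one_smul,
      sub_eq_add_neg]
    · rw [TN_smul]
      exact ENNReal.mul_ne_top enorm_ne_top hsingle
    · rw [TN_smul]
      exact ENNReal.mul_ne_top enorm_ne_top (hφ 0)
  have hsymb : ∀ t θ, expSum (φ' t) id (fun _ => (1 : ℂ)) θ = z t - σ θ := fun t θ => by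
    have e1 := hasSum_expSum (n := id) (X := fun _ => (1 : ℂ)) hσ0.summable (by simp) θ
    have e2 := (hasSum_ite_eq (0 : ℤ) (z t)).sub e1
    refine (tsum_congr fun n => ?_).trans e2.tsum_eq
    by_cases h : n = 0
    · subst h
      simp [φ', chr, sub_eq_add_neg]
    · simp [φ', h]
  have hconv : ∀ t, conv (φ' t) (ψ t) = Pi.single 0 1 := fun t => by
    ext n
    have := hasSum_fourierCoeffOn_mul (summable_norm_of_TN (hφ'.ne_top 0 t))
      ((hinv 0).continuous t) (hinvb t) n
    rw [conv, this.tsum_eq]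
    simp only [hsymb, mul_inv_cancel₀ (hne t _), fourierCoeffOn_one]
    simp [Pi.single_apply]
  have hr : UJ fun t => (z t • 1 - (toep φ + x)) * toep (ψ t) - 1 := by
    have := (hφ'.toep_mul_toep_sub hψ).sub ((UJ.const (ι := ι) hx hxJ).mul_toep hψ)
    convert this using 2 with t
    rw [hconv, toep_single, htoep]
    noncomm_ring
  have hr' : UJ fun t => toep (ψ t) * (z t • 1 - (toep φ + x)) - 1 := by
    have := (hψ.toep_mul_toep_sub hφ').sub (hψ.toep_mul (UJ.const (ι := ι) hx hxJ))
    convert this using 2 with t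
    rw [conv_comm, hconv, toep_single, htoep]
    noncomm_ring
  refine ⟨ψ, hψ, ?_⟩
  have := (hr'.mul_mul hr hym (inverse_bound hφ hx hxJ hz hy h1 h2)).sub (hψ.toep_mul hr)
  convert this using 2 with t
  set D := z t • 1 - (toep φ + x) with hD
  have e1 := h1 t
  have e2 := h2 t
  rw [← hD] at e1 e2
  set b := toep (ψ t)
  -- With r = D b - 1 and r' = b D - 1 this is y - b = r' y r - b r, so y itself is flanked by
  -- smoothing factors.
  calc y t - b = (b * (D * y t) - y t) * (D * b - 1) - b * (D * b - 1) := by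
        rw [e1, mul_one, sub_mul, mul_sub (y t), ← mul_assoc (y t), e2]
        noncomm_ring
    _ = _ := by noncomm_ring

/-! ### The smooth algebra in terms of matrix coefficients -/

theorem summable_wt_pow_mul {x : H →L[ℂ] H} {p : ℕ} (h : JN p x ≠ ⊤) :
    Summable fun κ => (wt κ : ℝ) ^ p * ‖coef κ x‖ := by
  have : Summable fun κ => ‖((wt κ : ℂ) ^ p) * coef κ x‖ := by
    refine tsum_enorm_ne_top_iff_summable_norm.1 (ne_of_eq_of_ne (tsum_congr fun κ => ?_) h)
    rw [enorm_mul, enorm_pow, mul_comm, ← ofReal_norm (wt κ : ℂ), Complex.norm_natCast,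
      ENNReal.ofReal_natCast]
  simpa only [norm_mul, norm_pow, Complex.norm_natCast] using this

/-- Summing the triple series over n first turns the inner sums into α*^k f_{kl}(β) α^l. -/
theorem hasSum_ofβ {f : ℕ → ℕ → ℝ → ℂ} {c : ℕ × ℕ × ℤ → ℂ} (hc : Summable fun κ => ‖c κ‖)
    (hf : ∀ k l n, fourierCoeffOn Real.two_pi_pos (f k l) n = c (k, l, n)) {x : H →L[ℂ] H}
    (hx : HasSum (fun κ => c κ • cell κ) x) :
    HasSum (fun p : ℕ × ℕ => (star α) ^ p.1 * ofβ (f p.1 p.2) * α ^ p.2) x := by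
  have h1 := ((Equiv.prodAssoc ℕ ℕ ℤ).hasSum_iff).2 hx
  refine h1.prod_fiberwise fun p => ?_
  have h2 : Summable fun n => c (p.1, p.2, n) • βpow n := by
    refine summable_smul_of_enorm (tsum_enorm_ne_top_iff_summable_norm.2 ?_) norm_βpow_le
    exact hc.comp_injective fun a b h => by simpa using h
  have h3 := h2.hasSum.mapL ((mulL ((star α) ^ p.1)).comp (mulR (α ^ p.2)))
  simp only [ofβ, hf]
  convert h3 using 1
  · ext1 n
    rw [map_smul]
    simp [cell, mul_assoc]
  · simp [mul_assoc]

theorem injective_key (k l : ℕ) : Function.Injective fun n : ℤ => ((k, l, n) : ℕ × ℕ × ℤ) :=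
  fun _ _ h => (Prod.mk.inj (Prod.mk.inj h).2).2

theorem moments_coef_key {w : H →L[ℂ] H} (hw : ∀ p, JN p w ≠ ⊤) (k l : ℕ) :
    Moments (fun n => coef (k, l, n) w) id := fun p =>
  ((moments_coef hw) p).comp_injective (i := fun n : ℤ => (k, l, n)) (injective_key k l)

/-- The Toeplitz operators with rapidly decaying symbol, up to smoothing operators. -/
def IsSmooth (x : H →L[ℂ] H) : Prop :=
  ∃ φ : ℤ → ℂ, (∀ p, TN p φ ≠ ⊤) ∧ x - toep φ ∈ commA ∧ ∀ p, JN p (x - toep φ) ≠ ⊤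

theorem periodic_expSum (c : ℤ → ℂ) :
    Function.Periodic (expSum c id fun _ => (1 : ℂ)) (2 * Real.pi) := fun θ => by
  simp only [expSum]
  refine tsum_congr fun n => ?_
  rw [periodic_chr]

theorem isSmooth_of_mem_smoothA {x : H →L[ℂ] H} (hx : x ∈ smoothA) : IsSmooth x := by
  obtain ⟨f, lam, lam', hf, hlam, hlam', x₁, x₂, x₃, h1, h2, h3, rfl⟩ := hx
  -- The two sequences glue to one symbol on ℤ; `lam' 0` does not enter, matching the sum over k >
  -- 0.
  let φ : ℤ → ℂ := fun n => if 0 ≤ n then lam n.toNat else lam' (-n).toNat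
  have hφT : UT fun _ : Unit => φ := by
    refine UT.of_bound fun m => ?_
    obtain ⟨C, hC⟩ := hlam m
    obtain ⟨D, hD⟩ := hlam' m
    refine ⟨max C D, fun _ n => ?_⟩
    have hb : ∀ (c : ℕ → ℂ) (j : ℕ), n.natAbs = j →
        |(n : ℝ)| ^ m * ‖c j‖ ≤ (1 + (j : ℝ)) ^ m * ‖c j‖ := by
      rintro c j rfl
      gcongr
      rw [Nat.cast_natAbs, Int.cast_abs]
      linarith
    simp only [φ]
    split_ifs with hn
    · exact le_max_of_le_left ((hb lam _ (by omega)).trans (hC _))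
    · exact le_max_of_le_right ((hb lam' _ (by omega)).trans (hD _))
  have hφ : ∀ p, TN p φ ≠ ⊤ := fun p => hφT.ne_top p ()
  have htoep : toep φ = x₂ + x₃ := by
    refine HasSum.tsum_eq (HasSum.of_nat_of_neg_add_one ?_ ?_)
    · simpa [φ, tau] using h2
    · convert h3 using 2 with n
      have e1 : ¬ (0 : ℤ) ≤ -((n : ℤ) + 1) := by omega
      have e2 : (-(-((n : ℤ) + 1))).toNat = n + 1 := by omega
      simp only [φ, tau, if_neg e1, e2]
  let c : ℕ × ℕ × ℤ → ℂ := fun κ => fourierCoeffOn Real.two_pi_pos (f κ.1 κ.2.1) κ.2.2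
  have hc : ∀ q : ℕ, ∃ C : ℝ, ∀ κ, (wt κ : ℝ) ^ q * ‖c κ‖ ≤ C := fun q => by
    -- Scaling f_{kl} by (1 + k + l)^q before taking Fourier coefficients gives decay jointly in k,
    -- l and n.
    have hG : ∀ m, UBd m fun (t : ℕ × ℕ) θ => ((1 + t.1 + t.2 : ℕ) : ℂ) ^ q * f t.1 t.2 θ := by
      refine UBd.of_contDiff (fun t => contDiff_const.mul (hf.contDiff _ _)) fun m => ?_
      obtain ⟨C, hC⟩ := hf.decay m q
      refine ⟨C, fun t θ => ?_⟩
      rw [iteratedDeriv_const_mul_field, norm_mul, norm_pow, Complex.norm_natCast]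
      simpa using hC t.1 t.2 θ
    have hper : ∀ t : ℕ × ℕ, Function.Periodic
        (fun θ => ((1 + t.1 + t.2 : ℕ) : ℂ) ^ q * f t.1 t.2 θ) (2 * Real.pi) := fun t θ => by
      simp only [hf.periodic t.1 t.2 θ]
    obtain ⟨C, hC⟩ := exists_bound_one_add
      (f := fun κ : ℕ × ℕ × ℤ => fourierCoeffOn Real.two_pi_pos
        (fun θ => ((1 + κ.1 + κ.2.1 : ℕ) : ℂ) ^ q * f κ.1 κ.2.1 θ) κ.2.2) (n := fun κ => κ.2.2)
      (fun m => ((hG m).fourier_bound hper).imp fun C hC κ => hC (κ.1, κ.2.1) κ.2.2) q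
    refine ⟨C, fun κ => (hC κ).trans' ?_⟩
    rw [fourierCoeffOn.const_mul, norm_mul, norm_pow, Complex.norm_natCast, ← mul_assoc,
      ← mul_pow]
    gcongr
    norm_cast
    rw [mul_comm]
    simp only [wt, add_assoc 1]
    exact le_one_add_mul_one_add (by omega)
  have hcJ : ∀ p, ∃ C : ENNReal, C ≠ ⊤ ∧ ∀ κ, ‖c κ‖ₑ * (wt κ : ENNReal) ^ p ≤ C := fun p => by
    obtain ⟨C, hC⟩ := hc p
    exact ⟨_, ENNReal.ofReal_ne_top, fun κ => enorm_mul_pow_le (hC κ)⟩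
  have hcs : ∑' κ, ‖c κ‖ₑ ≠ ⊤ := by
    obtain ⟨C, hC, h⟩ := hcJ 6
    refine ne_top_of_le_ne_top (ENNReal.mul_ne_top hC tsum_wt_inv_ne_top) ?_
    rw [← ENNReal.tsum_mul_left]
    refine ENNReal.tsum_le_tsum fun κ => ?_
    have := mul_pow_le_of_mul_pow_add_le (p := 0) (q := 6) (x := ‖c κ‖ₑ) (a := wt κ)
      (by have := one_le_wt κ; omega) (by simpa using h κ)
    simpa using this
  have hW := (summable_smul_of_enorm hcs norm_cell_le).hasSum
  have hWx := (hasSum_ofβ (f := f) (tsum_enorm_ne_top_iff_summable_norm.1 hcs)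
    (fun _ _ _ => rfl) hW).unique h1
  rw [hWx] at hW
  have hx₁ : x₁ + x₂ + x₃ - toep φ = x₁ := by
    rw [htoep]
    abel
  refine ⟨φ, hφ, ?_, fun p => ?_⟩
  · rw [hx₁]
    exact mem_of_hasSum isClosed_commA hW fun κ => commA.smul_mem (cell_mem_commA κ) _
  · rw [hx₁]
    obtain ⟨C, hC, h⟩ := hcJ (p + 6)
    refine ne_top_of_le_ne_top (ENNReal.mul_ne_top hC tsum_wt_inv_ne_top)
      (JN_le_of_bound fun κ => ?_)
    rw [coef_of_hasSum_cell hW]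
    exact h κ

theorem rapidDecay_of_TN {φ : ℤ → ℂ} (hφ : ∀ p, TN p φ ≠ ⊤) {i : ℕ → ℤ}
    (hi : ∀ k, (i k).natAbs = k) : RapidDecay fun k => φ (i k) := fun p => by
  refine ⟨(TN p φ).toReal, fun k => ?_⟩
  have h := ENNReal.toReal_mono (hφ p)
    (ENNReal.le_tsum (f := fun n : ℤ => ‖φ n‖ₑ * ((1 + n.natAbs : ℕ) : ENNReal) ^ p) (i k))
  refine h.trans_eq' ?_
  rw [hi, ENNReal.toReal_mul, toReal_enorm, ENNReal.toReal_pow, ENNReal.toReal_natCast, mul_comm]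
  push_cast
  rfl

/-- Each factor 1 + k + l and each derivative, which brings down |n|, costs at most one power of the
weight. The series over n at fixed (k, l) is then part of the full sum defining `JN (p + m) w`. -/
theorem smoothRapidDecay_expSum {w : H →L[ℂ] H} (hw : ∀ p, JN p w ≠ ⊤) :
    SmoothRapidDecay fun k l => expSum (fun n => coef (k, l, n) w) id fun _ => (1 : ℂ) := by
  have hm := moments_coef_key hw
  refine ⟨fun k l => (hm k l).contDiff (by simp), fun k l => periodic_expSum _, fun m p => ?_⟩
  refine ⟨∑' κ, (wt κ : ℝ) ^ (p + m) * ‖coef κ w‖, fun k l θ => ?_⟩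
  have hs := summable_wt_pow_mul (hw (p + m))
  have hnorm : ∀ n : ℤ, ‖coef (k, l, n) w * (Complex.I * n) ^ m‖ =
      |(n : ℝ)| ^ m * ‖coef (k, l, n) w‖ := fun n => by
    rw [norm_mul, norm_pow, norm_mul, Complex.norm_I, one_mul, Complex.norm_intCast, mul_comm]
  rw [(hm k l).iteratedDeriv (by simp)]
  calc _ ≤ (1 + (k : ℝ) + l) ^ p * ∑' n : ℤ, |(n : ℝ)| ^ m * ‖coef (k, l, n) w‖ := by
        gcongr
        refine (norm_expSum_le ?_ (by simp) θ).trans_eq (tsum_congr hnorm)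
        simp only [id, hnorm]
        exact hm k l m
    _ = ∑' n : ℤ, (1 + (k : ℝ) + l) ^ p * (|(n : ℝ)| ^ m * ‖coef (k, l, n) w‖) :=
        tsum_mul_left.symm
    _ ≤ ∑' n : ℤ, (wt (k, l, n) : ℝ) ^ (p + m) * ‖coef (k, l, n) w‖ := by
        refine Summable.tsum_le_tsum (fun n => ?_) ((hm k l m).mul_left _)
          (hs.comp_injective (i := fun n : ℤ => (k, l, n)) (injective_key k l))
        rw [pow_add, ← mul_assoc]
        gcongr
        · norm_cast
          unfold wt
          dsimp only
          omega
        · rw [← Int.cast_abs, ← Nat.cast_natAbs]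
          norm_cast
          unfold wt
          dsimp only
          omega
    _ ≤ _ := tsum_comp_le_tsum_of_inj hs (fun κ => by positivity)
        (i := fun n : ℤ => (k, l, n)) (injective_key k l)

theorem hasSum_ofβ_of_mem {w : H →L[ℂ] H} (hw : w ∈ commA) (hwJ : ∀ p, JN p w ≠ ⊤) :
    HasSum (fun p : ℕ × ℕ => (star α) ^ p.1 *
      ofβ (expSum (fun n => coef (p.1, p.2, n) w) id fun _ => (1 : ℂ)) * α ^ p.2) w := by
  have hc := summable_wt_pow_mul (hwJ 0)
  simp only [pow_zero, one_mul] at hc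
  exact hasSum_ofβ (f := fun k l => expSum (fun n => coef (k, l, n) w) id fun _ => (1 : ℂ))
    (c := fun κ => coef κ w) hc
    (fun k l n => fourierCoeffOn_expSum (moments_coef_key hwJ k l).summable n)
    (hasSum_cell hw (hwJ 0))

theorem mem_smoothA_of_isSmooth {x : H →L[ℂ] H} (hx : IsSmooth x) : x ∈ smoothA := by
  obtain ⟨φ, hφ, hw, hwJ⟩ := hx
  have hs := hasSum_toep (hφ 0)
  have h2 : Summable fun n : ℕ => φ n • tau n := hs.summable.comp_injective (i := fun n : ℕ => (n : ℤ)) Nat.cast_injective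
  have hinj : Function.Injective fun n : ℕ => -((n : ℤ) + 1) := fun a b h => by
    simp only at h
    omega
  have h3 : Summable fun n : ℕ => φ (-((n : ℤ) + 1)) • tau (-((n : ℤ) + 1)) :=
    hs.summable.comp_injective (i := fun n : ℕ => -((n : ℤ) + 1)) hinj
  have hsum := hs.unique (HasSum.of_nat_of_neg_add_one (f := fun n : ℤ => φ n • tau n)
    h2.hasSum h3.hasSum)
  have e2 : ∀ n : ℕ, tau n = α ^ n := fun n => by simp [tau]
  have e3 : ∀ n : ℕ, tau (-((n : ℤ) + 1)) = star α ^ (n + 1) := fun n => by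
    have h4 : ¬ (0 : ℤ) ≤ -((n : ℤ) + 1) := by omega
    have h5 : (-(-((n : ℤ) + 1))).toNat = n + 1 := by omega
    rw [tau, if_neg h4, h5]
  simp only [e2] at h2 hsum
  simp only [e3] at h3 hsum
  have hlam : RapidDecay fun l => φ l := rapidDecay_of_TN hφ (i := fun k => k) Int.natAbs_natCast
  have hlam' : RapidDecay fun k => φ (-k) := rapidDecay_of_TN hφ (i := fun k => -k) fun k => by
    rw [Int.natAbs_neg, Int.natAbs_natCast]
  refine ⟨fun k l => expSum (fun n => coef (k, l, n) (x - toep φ)) id fun _ => (1 : ℂ),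
    fun l => φ l, fun k => φ (-k), smoothRapidDecay_expSum hwJ, hlam, hlam', x - toep φ, _, _, ?_, h2.hasSum,
    by simpa only [Nat.cast_add, Nat.cast_one] using h3.hasSum, ?_⟩
  · exact hasSum_ofβ_of_mem hw hwJ
  · rw [add_assoc, ← hsum]
    abel

theorem mem_smoothA_iff {x : H →L[ℂ] H} : x ∈ smoothA ↔ IsSmooth x :=
  ⟨isSmooth_of_mem_smoothA, mem_smoothA_of_isSmooth⟩

theorem IsSmooth.mem_cstarA {x : H →L[ℂ] H} (hx : IsSmooth x) : x ∈ cstarA := by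
  obtain ⟨φ, -, hw, hwJ⟩ := hx
  have h := mem_of_hasSum isClosed_cstarA (hasSum_cell hw (hwJ 0))
    fun κ => cstarA.smul_mem (cell_mem_cstarA κ) _
  simpa using add_mem h (toep_mem_cstarA φ)

/-! ### Algebraic operations -/

theorem IsSmooth.of_family {x : H →L[ℂ] H} {φ : ℤ → ℂ} (hφ : ∀ p, TN p φ ≠ ⊤)
    (h : UJ fun _ : Unit => x - toep φ) : IsSmooth x :=
  ⟨φ, hφ, h.mem (), fun p => h.ne_top p ()⟩

theorem IsSmooth.exists_family {x : H →L[ℂ] H} (hx : IsSmooth x) :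
    ∃ φ, UT (fun _ : Unit => φ) ∧ UJ fun _ : Unit => x - toep φ := by
  obtain ⟨φ, hφ, hw, hwJ⟩ := hx
  exact ⟨φ, UT.const hφ, UJ.const hw hwJ⟩

theorem isSmooth_smul_one (c : ℂ) : IsSmooth (c • 1) := by
  have h1 : ∀ p, TN p (Pi.single 0 1 : ℤ → ℂ) ≠ ⊤ := fun p => by
    rw [TN_single]
    exact ENNReal.one_ne_top
  refine ⟨c • Pi.single 0 1, fun p => ?_, ?_⟩
  · rw [TN_smul]
    exact ENNReal.mul_ne_top enorm_ne_top (h1 p)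
  · rw [toep_smul c (h1 0), toep_single, sub_self]
    exact ⟨zero_mem _, fun p => by rw [JN_zero]; exact ENNReal.zero_ne_top⟩

theorem IsSmooth.add {x y : H →L[ℂ] H} (hx : IsSmooth x) (hy : IsSmooth y) :
    IsSmooth (x + y) := by
  obtain ⟨φ, hφ, hw⟩ := hx.exists_family
  obtain ⟨ψ, hψ, hv⟩ := hy.exists_family
  refine IsSmooth.of_family (φ := φ + ψ) (fun p => ne_top_of_le_ne_top
    (ENNReal.add_ne_top.2 ⟨hφ.ne_top p (), hψ.ne_top p ()⟩) (TN_add p φ ψ)) ?_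
  have := hw.add hv
  convert this using 2
  rw [toep_add (hφ.ne_top 0 ()) (hψ.ne_top 0 ())]
  abel

theorem IsSmooth.mul {x y : H →L[ℂ] H} (hx : IsSmooth x) (hy : IsSmooth y) :
    IsSmooth (x * y) := by
  obtain ⟨φ, hφ, hw⟩ := hx.exists_family
  obtain ⟨ψ, hψ, hv⟩ := hy.exists_family
  refine IsSmooth.of_family (φ := conv φ ψ) (fun p => ne_top_of_le_ne_top
    (ENNReal.mul_ne_top (hφ.ne_top p ()) (hψ.ne_top p ())) (TN_conv_le p φ ψ)) ?_
  have := (((hφ.toep_mul_toep_sub hψ).add (hw.mul hv)).add (hφ.toep_mul hv)).add (hw.mul_toep hψ)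
  convert this using 2
  noncomm_ring

theorem IsSmooth.smul {x : H →L[ℂ] H} (c : ℂ) (hx : IsSmooth x) : IsSmooth (c • x) := by
  simpa using (isSmooth_smul_one c).mul hx

theorem IsSmooth.of_mul_eq_one {x y : H →L[ℂ] H} (hx : IsSmooth x) (hy : y ∈ commA)
    (h1 : x * y = 1) (h2 : y * x = 1) : IsSmooth y := by
  obtain ⟨φ, hφ, hw, hwJ⟩ := hx
  -- The case z = 0 of a one-element family; the inverse of 0 - x is -y.
  obtain ⟨ψ, hψ, hJ⟩ := exists_symbol_inverse (ι := Unit) (z := fun _ => 0) (y := fun _ => -y)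
    (R := 0) (C := ‖y‖) hφ hw hwJ (by simp) (by simp) (fun _ => neg_mem hy) (by simpa using h1)
    (by simpa using h2)
  have := (IsSmooth.of_family (hψ.ne_top · ()) hJ).smul (-1)
  simpa using this

/-! ### Integrals of uniform families -/

theorem coef_toep {φ : ℤ → ℂ} (hφ : TN 0 φ ≠ ⊤) (κ : ℕ × ℕ × ℤ) :
    coef κ (toep φ) = if κ.2.2 = 0 then φ (κ.2.1 - κ.1) else 0 := by
  refine ((hasSum_toep hφ).mapL (coef κ)).unique ?_
  by_cases h : κ.2.2 = 0
  · convert hasSum_ite_eq ((κ.2.1 : ℤ) - κ.1) (φ (κ.2.1 - κ.1)) using 2 with n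
    · rw [map_smul, coef_tau]
      by_cases h' : n = κ.2.1 - κ.1 <;> simp [h, h']
    · simp [h]
  · simp [h, coef_tau, hasSum_zero]

/-- The coefficients of `toep φ` are constant along the diagonal l - k = n, while those of the
smoothing part tend to zero there. The symbol is thus a pointwise limit of continuous functionals of
the operator, whence its measurability in parameters. -/
theorem tendsto_coef_symbol {φ : ℤ → ℂ} {y : H →L[ℂ] H} (hφ : TN 0 φ ≠ ⊤)
    (hy : JN 0 (y - toep φ) ≠ ⊤) (n : ℤ) :
    Filter.Tendsto (fun k : ℕ => coef (k + (-n).toNat, k + n.toNat, 0) y) Filter.atTop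
      (𝓝 (φ n)) := by
  have hs : Summable fun κ => coef κ (y - toep φ) :=
    Summable.of_enorm (by simpa [JN] using hy)
  have hinj : Function.Injective fun k : ℕ => (k + (-n).toNat, k + n.toNat, (0 : ℤ)) :=
    fun a b h => by simpa using h
  have h1 := hs.tendsto_cofinite_zero.comp hinj.tendsto_cofinite
  rw [Nat.cofinite_eq_atTop] at h1
  have h2 := h1.add_const (φ n)
  rw [zero_add] at h2
  refine h2.congr fun k => ?_
  simp only [Function.comp_apply]
  rw [map_sub, coef_toep hφ]
  have : ((k + n.toNat : ℕ) : ℤ) - (k + (-n).toNat : ℕ) = n := by omega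
  rw [if_pos rfl, this, sub_add_cancel]

theorem enorm_integral_mul_le {h : ℝ → ℂ} {a C : ENNReal} (ha : a ≠ ⊤)
    (hh : ∀ t, ‖h t‖ₑ * a ≤ C) : ‖∫ t in (0 : ℝ)..1, h t‖ₑ * a ≤ C := by
  rw [intervalIntegral.integral_of_le zero_le_one]
  calc _ ≤ (∫⁻ t in Ioc (0 : ℝ) 1, ‖h t‖ₑ) * a := by
        gcongr
        exact MeasureTheory.enorm_integral_le_lintegral_enorm _
    _ = ∫⁻ t in Ioc (0 : ℝ) 1, ‖h t‖ₑ * a := (MeasureTheory.lintegral_mul_const' _ _ ha).symm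
    _ ≤ ∫⁻ _ in Ioc (0 : ℝ) 1, C := MeasureTheory.lintegral_mono fun t => hh t
    _ = C := by simp

/-- Symbol and remainder are integrated separately, coefficient by coefficient. Pointwise weighted
bounds pass under the integral, and two extra powers (for the symbol) or six (for the remainder)
restore the ℓ¹ bounds. -/
theorem isSmooth_integral {y : ℝ → H →L[ℂ] H} {ψ : ℝ → ℤ → ℂ} {g : ℝ → ℂ} (hy : Continuous y)
    (hg : Continuous g) {G : ENNReal} (hG : G ≠ ⊤) (hgG : ∀ t, ‖g t‖ₑ ≤ G) (hψ : UT ψ)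
    (hJ : UJ fun t => y t - toep (ψ t)) (hm : ∫ t in (0 : ℝ)..1, g t • y t ∈ commA) :
    IsSmooth (∫ t in (0 : ℝ)..1, g t • y t) := by
  have hψm : ∀ n, MeasureTheory.StronglyMeasurable fun t => ψ t n := fun n =>
    stronglyMeasurable_of_tendsto Filter.atTop
      (fun k : ℕ => ((coef (k + (-n).toNat, k + n.toNat, 0)).continuous.comp hy).stronglyMeasurable)
      (tendsto_pi_nhds.2 fun t => tendsto_coef_symbol (hψ.ne_top 0 t) (hJ.ne_top 0 t) n)
  have hψb : ∀ (p : ℕ) (C : ENNReal), (∀ t, TN p (ψ t) ≤ C) → ∀ t n,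
      ‖g t * ψ t n‖ₑ * ((1 + n.natAbs : ℕ) : ENNReal) ^ p ≤ G * C := fun p C hC t n => by
    rw [enorm_mul, mul_assoc]
    gcongr
    · exact hgG t
    · exact (ENNReal.le_tsum n).trans (hC t)
  have hJb : ∀ (p : ℕ) (C : ENNReal), (∀ t, JN p (y t - toep (ψ t)) ≤ C) → ∀ t κ,
      ‖g t * coef κ (y t - toep (ψ t))‖ₑ * (wt κ : ENNReal) ^ p ≤ G * C := fun p C hC t κ => by
    rw [enorm_mul, mul_assoc]
    gcongr
    · exact hgG t
    · exact (ENNReal.le_tsum κ).trans (hC t)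
  let φ : ℤ → ℂ := fun n => ∫ t in (0 : ℝ)..1, g t * ψ t n
  have hφ : ∀ p, TN p φ ≠ ⊤ := fun p => by
    obtain ⟨C, hC, h⟩ := hψ (p + 2)
    refine ne_top_of_le_ne_top (ENNReal.mul_ne_top (ENNReal.mul_ne_top hG hC)
      tsum_int_inv_sq_ne_top) (tsum_int_le_of_bound fun n => ?_)
    exact enorm_integral_mul_le (by finiteness) fun t => hψb _ C h t n
  have hint : ∀ n, IntervalIntegrable (fun t => g t * ψ t n) MeasureTheory.volume 0 1 := fun n => by
    obtain ⟨C, hC, h⟩ := hψ 0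
    have hbd : ∀ t, ‖g t * ψ t n‖ ≤ (G * C).toReal := fun t => by
      rw [← toReal_enorm]
      exact ENNReal.toReal_mono (ENNReal.mul_ne_top hG hC) (by simpa using hψb 0 C h t n)
    exact (intervalIntegrable_const (c := (G * C).toReal)).mono_fun
      (hg.stronglyMeasurable.mul (hψm n)).aestronglyMeasurable
      (Filter.Eventually.of_forall fun t => (hbd t).trans (le_abs_self _))
  have hcoef : ∀ κ, coef κ ((∫ t in (0 : ℝ)..1, g t • y t) - toep φ) =
      ∫ t in (0 : ℝ)..1, g t * coef κ (y t - toep (ψ t)) := fun κ => by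
    have hc1 : Continuous fun t => g t * coef κ (y t) := hg.mul ((coef κ).continuous.comp hy)
    have hc2 : IntervalIntegrable (fun t => g t • y t) MeasureTheory.volume 0 1 :=
      (hg.smul hy).intervalIntegrable _ _
    rw [map_sub, coef_toep (hφ 0), ← ContinuousLinearMap.intervalIntegral_comp_comm _ hc2]
    simp only [map_smul, smul_eq_mul, map_sub, mul_sub, coef_toep (hψ.ne_top 0 _)]
    split_ifs
    · rw [intervalIntegral.integral_sub (hc1.intervalIntegrable _ _) (hint _)]
    · simp
  refine ⟨φ, hφ, sub_mem hm (toep_mem_commA φ), fun p => ?_⟩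
  obtain ⟨C, hC, h⟩ := hJ.bdd (p + 6)
  refine ne_top_of_le_ne_top (ENNReal.mul_ne_top (ENNReal.mul_ne_top hG hC)
    tsum_wt_inv_ne_top) (JN_le_of_bound fun κ => ?_)
  rw [hcoef]
  exact enorm_integral_mul_le (by finiteness) fun t => hJb _ C h t κ

/-! ### Stability under holomorphic functional calculus -/

/-- The smooth algebra as a subalgebra of the C*-algebra. -/
def smoothSubalgebra : Subalgebra ℂ cstarA where
  carrier := {x | IsSmooth (x : H →L[ℂ] H)}
  mul_mem' := fun hx hy => hx.mul hy
  add_mem' := fun hx hy => hx.add hy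
  algebraMap_mem' := fun c => isSmooth_smul_one c

/-- The inclusion of the C*-algebra into the bounded operators. -/
def cstarVal : cstarA →L[ℂ] (H →L[ℂ] H) :=
  LinearMap.mkContinuous
    { toFun := fun x => x
      map_add' := fun _ _ => rfl
      map_smul' := fun _ _ => rfl } 1 fun x => (one_mul ‖x‖).ge

theorem cstarVal_apply (x : cstarA) : cstarVal x = x := rfl

theorem IsSmooth.integral_resolvent {x : cstarA} (hx : IsSmooth (x : H →L[ℂ] H)) {g γ : ℝ → ℂ}
    (hg : ContinuousOn g (Icc 0 1)) (hγ : ContinuousOn γ (Icc 0 1))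
    (hγx : ∀ t ∈ Icc (0 : ℝ) 1, γ t ∉ spectrum ℂ x) :
    IsSmooth (↑(∫ t in (0 : ℝ)..1, g t • resolvent x (γ t)) : H →L[ℂ] H) := by
  -- Retracting ℝ onto [0, 1] makes all functions globally continuous, and compactness then gives
  -- the uniform bounds on z and on the resolvent that `exists_symbol_inverse` requires.
  set P : ℝ → ℝ := fun t => projIcc 0 1 zero_le_one t with hP
  have hPm : ∀ t, P t ∈ Icc (0 : ℝ) 1 := fun t => (projIcc 0 1 zero_le_one t).2
  have hPP : ∀ t ∈ Icc (0 : ℝ) 1, P t = t := fun t ht => by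
    simp only [hP, projIcc_of_mem zero_le_one ht]
  have hPc : Continuous P := continuous_subtype_val.comp continuous_projIcc
  have hgc : Continuous fun t => g (P t) := hg.comp_continuous hPc hPm
  have hγc : Continuous fun t => γ (P t) := hγ.comp_continuous hPc hPm
  have hunit : ∀ t, IsUnit (algebraMap ℂ cstarA (γ (P t)) - x) := fun t =>
    spectrum.notMem_iff.1 (hγx _ (hPm t))
  have hRc : Continuous fun t => resolvent x (γ (P t)) := by
    refine continuous_iff_continuousAt.2 fun t => ?_
    obtain ⟨u, hu⟩ := hunit t
    have h1 := NormedRing.inverse_continuousAt u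
    rw [hu] at h1
    exact ContinuousAt.comp (f := fun t => algebraMap ℂ cstarA (γ (P t)) - x) h1
      (((algebraMapCLM ℂ cstarA).continuous.comp hγc).sub continuous_const).continuousAt
  have hbound : ∀ {E : Type} [NormedAddCommGroup E] (h : ℝ → E), (Continuous fun t => h (P t)) →
      ∃ C, ∀ t, ‖h (P t)‖ ≤ C := by
    intro E _ h hh
    obtain ⟨C, hC⟩ := isCompact_Icc.exists_bound_of_continuousOn
      (hh.continuousOn (s := Icc (0 : ℝ) 1))
    exact ⟨C, fun t => by simpa only [hPP _ (hPm t)] using hC (P t) (hPm t)⟩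
  obtain ⟨G, hG⟩ := hbound g hgc
  obtain ⟨Z, hZ⟩ := hbound γ hγc
  obtain ⟨C, hC⟩ := hbound (fun t => resolvent x (γ t)) hRc
  have heq : (↑(∫ t in (0 : ℝ)..1, g t • resolvent x (γ t)) : H →L[ℂ] H) =
      ∫ t in (0 : ℝ)..1, g (P t) • cstarVal (resolvent x (γ (P t))) := by
    have h1 : ∫ t in (0 : ℝ)..1, g t • resolvent x (γ t) =
        ∫ t in (0 : ℝ)..1, g (P t) • resolvent x (γ (P t)) := by
      refine intervalIntegral.integral_congr fun t ht => ?_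
      rw [uIcc_of_le zero_le_one] at ht
      simp only [hPP t ht]
    have hi : IntervalIntegrable (fun t => g (P t) • resolvent x (γ (P t)))
        MeasureTheory.volume 0 1 := (hgc.smul hRc).intervalIntegrable _ _
    rw [h1, ← cstarVal_apply, ← ContinuousLinearMap.intervalIntegral_comp_comm _ hi]
    simp only [map_smul]
  have hmem := cstarA_le_commA (∫ t in (0 : ℝ)..1, g t • resolvent x (γ t)).2
  rw [heq] at hmem ⊢
  obtain ⟨φ, hφ, hw, hwJ⟩ := hx
  have h1 : ∀ t, (γ (P t) • 1 - (x : H →L[ℂ] H)) * cstarVal (resolvent x (γ (P t))) = 1 :=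
    fun t => by
      have := Ring.mul_inverse_cancel _ (hunit t)
      rw [Algebra.algebraMap_eq_smul_one] at this
      exact congrArg Subtype.val this
  have h2 : ∀ t, cstarVal (resolvent x (γ (P t))) * (γ (P t) • 1 - (x : H →L[ℂ] H)) = 1 :=
    fun t => by
      have := Ring.inverse_mul_cancel _ (hunit t)
      rw [Algebra.algebraMap_eq_smul_one] at this
      exact congrArg Subtype.val this
  obtain ⟨ψ, hψ, hJ⟩ := exists_symbol_inverse (z := fun t => γ (P t))
    (y := fun t => cstarVal (resolvent x (γ (P t)))) (R := Z) (C := C) hφ hw hwJ hZ hC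
    (fun t => cstarA_le_commA (resolvent x (γ (P t))).2)
    (by simpa only [add_sub_cancel] using h1) (by simpa only [add_sub_cancel] using h2)
  refine isSmooth_integral (cstarVal.continuous.comp hRc) hgc (ENNReal.ofReal_ne_top (r := G))
    (fun t => ?_) hψ hJ hmem
  rw [← ofReal_norm]
  exact ENNReal.ofReal_le_ofReal (hG t)

theorem stableUnderHolomorphicCalculus_smoothSubalgebra :
    StableUnderHolomorphicCalculus smoothSubalgebra := by
  intro x hx U hU _ f hf Γ
  refine smoothSubalgebra.smul_mem (sum_mem fun j _ => ?_) _
  have hγ := Γ.contDiff j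
  refine IsSmooth.integral_resolvent hx (g := fun t => f (Γ.path j t) * deriv (Γ.path j) t)
    ?_ hγ.continuous.continuousOn fun t ht => (Γ.mem j t ht).2
  exact (hf.continuousOn.comp hγ.continuous.continuousOn fun t ht => (Γ.mem j t ht).1).mul
    (hγ.continuous_deriv le_rfl).continuousOn

end SUq0

end

theorem proposition1 :
    SUq0.smoothA ⊆ (SUq0.cstarA : Set (SUq0.H →L[ℂ] SUq0.H)) ∧
    ∃ S : Subalgebra ℂ SUq0.cstarA,
      (∀ x : SUq0.cstarA, x ∈ S ↔ (x : SUq0.H →L[ℂ] SUq0.H) ∈ SUq0.smoothA) ∧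
      (∀ x ∈ S, ∀ y : SUq0.cstarA, x * y = 1 → y * x = 1 → y ∈ S) ∧
      StableUnderHolomorphicCalculus S :=
  ⟨fun _ hx => (SUq0.isSmooth_of_mem_smoothA hx).mem_cstarA, SUq0.smoothSubalgebra,
    fun _ => SUq0.mem_smoothA_iff.symm,
    fun _ hx y h1 h2 => SUq0.IsSmooth.of_mul_eq_one hx (SUq0.cstarA_le_commA y.2)
      (congrArg Subtype.val h1) (congrArg Subtype.val h2),
    SUq0.stableUnderHolomorphicCalculus_smoothSubalgebra⟩
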